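/- Let $\mathbb K$ be an algebraically closed field and $\Lambda$ a finite dimensional $\mathbb K$-algebra. Let $\operatorname{proj}\Lambda$ be the category of finitely generated projective right $\Lambda$-modules. The length $\ell(X)$ of a nonzero $X\in K^b(\operatorname{proj}\Lambda)$ is $s-r$, where $r\le s$ are the first and the last degree in which the representative of $X$ without nonzero contractible direct summands is nonzero, and the strong global dimension $\operatorname{s.gl.dim}(\Lambda)$ is the supremum of $\ell(X)$ over the indecomposable $X\in K^b(\operatorname{proj}\Lambda)$. Assume that $\eta=\operatorname{s.gl.dim}(\Lambda)$ is finite (equivalently, that $\Lambda$ is piecewise hereditary) and $\eta\ge 1$. For $n\ge 1$ let $C_n$ be the category of complexes $X$ over $\operatorname{proj}\Lambda$ with $X^j=0$ for $j\notin\{1,\dots,n\}$. An almost split sequence in $C_n$ is a pair $X\xrightarrow{f}B\xrightarrow{g}Y$ that is split exact in every degree, with $f$ minimal left almost split and $g$ minimal right almost split in $C_n$. The left and the right inclusion $C_n\to C_{n+1}$ send $X^1\to\dots\to X^n$ to $0\to X^1\to\dots\to X^n$ and to $X^1\to\dots\to X^n\to 0$; the left and the right truncation $C_{n+1}\to C_n$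 delete the first, respectively the last, cell. For a word $w$ of $k$ letters in $\{\text{left},\text{right}\}$ let $I_w:C_n\to C_{n+k}$ be the composite of the corresponding inclusions and $T_w:C_{n+k}\to C_n$ the composite of the corresponding truncations in the opposite order. Then, for every $i\ge 2$, with $w$ ranging over the words of $i-1$ letters: (i) Let $X,Y$ be indecomposable in $C_{\eta+1}$. A morphism $f:X\to Y$ is irreducible in $C_{\eta+1}$ if and only if $I_w(f)$ is irreducible in $C_{\eta+i}$ for some $w$. Conversely, if $f:X\to Y$ is an irreducible morphism of $C_{\eta+i}$ between indecomposable complexes, then for some $w$ the complexes $T_w(X)$ and $T_w(Y)$ are indecomposable, $T_w(f)$ is irreducible in $C_{\eta+1}$, and $f\cong I_w(T_w(f))$. (ii) Let $\delta:X\to B\to Y$ be a sequence in $C_{\eta+1}$ (with composite zero) and $X,Y$ indecomposable. Then $\delta$ is an almost split sequence in $C_{\eta+1}$ if and only if $I_w(\delta)$ is an almost split sequence in $C_{\eta+i}$ for some $w$. Conversely, if $\delta:X\to B\to Y$ is an almost split sequence in $C_{\eta+i}$ with $X,Y$ indecomposable, then for some $w$ the complexes $T_w(X)$ and $T_w(Y)$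 are indecomposable, $T_w(\delta)$ is an almost split sequence in $C_{\eta+1}$, and $\delta\cong I_w(T_w(\delta))$. -/

import Mathlib

open CategoryTheory CategoryTheory.Limits

universe v u

namespace CnProj

/-! ### Irreducible morphisms and almost split morphisms in a category -/

section Category

variable {C : Type u} [Category.{v} C]

/-- A morphism is irreducible if it is neither a section nor a retraction and, for every
factorization `f = g ≫ h`, the first factor `g` is a section or the second factor `h` is a
retraction. -/
structure IsIrreducible {X Y : C} (f : X ⟶ Y) : Prop where
  not_section : ¬ IsSplitMono f
  not_retraction : ¬ IsSplitEpi f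
  factor : ∀ (Z : C) (g : X ⟶ Z) (h : Z ⟶ Y), g ≫ h = f → IsSplitMono g ∨ IsSplitEpi h

/-- `f : E ⟶ M` is right almost split: it is not a retraction, and every morphism to `M` that is
not a retraction factors through `f`. -/
structure IsRightAlmostSplit {E M : C} (f : E ⟶ M) : Prop where
  not_retraction : ¬ IsSplitEpi f
  factor : ∀ (X : C) (g : X ⟶ M), ¬ IsSplitEpi g → ∃ s : X ⟶ E, s ≫ f = g

/-- `f : M ⟶ E` is left almost split: it is not a section, and every morphism from `M` that is
not a section factors through `f`. -/
structure IsLeftAlmostSplit {M E : C} (f : M ⟶ E) : Prop where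
  not_section : ¬ IsSplitMono f
  factor : ∀ (X : C) (g : M ⟶ X), ¬ IsSplitMono g → ∃ s : E ⟶ X, f ≫ s = g

/-- `f : E ⟶ M` is minimal right: every endomorphism `u` of `E` with `u ≫ f = f` is an
automorphism. -/
def IsMinimalRight {E M : C} (f : E ⟶ M) : Prop :=
  ∀ u : E ⟶ E, u ≫ f = f → IsIso u

/-- `f : M ⟶ E` is minimal left: every endomorphism `u` of `E` with `f ≫ u = f` is an
automorphism. -/
def IsMinimalLeft {M E : C} (f : M ⟶ E) : Prop :=
  ∀ u : E ⟶ E, f ≫ u = f → IsIso u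

end Category

/-! ### Complexes of fixed size -/

section FixedSize

variable (V : Type u) [Category.{v} V] [Preadditive V]

/-- The complexes `X` with `X^j = 0` for `j ∉ {1, …, n}`. -/
def IsFixedSize (n : ℕ) : ObjectProperty (CochainComplex V ℤ) :=
  fun X ↦ ∀ j : ℤ, (j < 1 ∨ (n : ℤ) < j) → IsZero (X.X j)

/-- The category `C_n(V)` of complexes of fixed size `n`. -/
abbrev FixedSize (n : ℕ) := (IsFixedSize V n).FullSubcategory

instance (n : ℕ) [HasBinaryBiproducts V] : (IsFixedSize V n).IsClosedUnderBinaryProducts where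
  limitsOfShape_le := by
    rintro K ⟨p⟩ j hj
    rw [IsZero.iff_id_eq_zero]
    exact (isLimitOfPreserves (HomologicalComplex.eval _ _ j) p.isLimit).hom_ext
      (fun i ↦ (p.prop_diag_obj i j hj).eq_of_tgt _ _)

instance (n : ℕ) [HasBinaryBiproducts V] : HasBinaryBiproducts (FixedSize V n) :=
  HasBinaryBiproducts.of_hasBinaryProducts

variable {V} in
/-- The functor sending a complex of fixed size to its `j`-th cell. -/
abbrev cell {n : ℕ} (j : ℤ) : FixedSize V n ⥤ V :=
  (IsFixedSize V n).ι ⋙ HomologicalComplex.eval V (ComplexShape.up ℤ) j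

variable {V} in
/-- The conflations of `C_n(V)`: the composable pairs `X ⟶ Y ⟶ Z` such that in every degree `j`
the sequence `0 ⟶ X^j ⟶ Y^j ⟶ Z^j ⟶ 0` is split exact. -/
def IsConflation {n : ℕ} (S : ShortComplex (FixedSize V n)) : Prop :=
  ∀ j : ℤ, Nonempty (S.map (cell j)).Splitting

variable {V} in
/-- The almost split sequences of `C_n(V)`: the conflations `X ⟶ Y ⟶ Z` whose first morphism is
minimal left almost split and whose second morphism is minimal right almost split. -/
structure IsAlmostSplitSequence {n : ℕ} (S : ShortComplex (FixedSize V n)) : Prop where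
  conflation : IsConflation S
  left_almostSplit : IsLeftAlmostSplit S.f
  left_minimal : IsMinimalLeft S.f
  right_almostSplit : IsRightAlmostSplit S.g
  right_minimal : IsMinimalRight S.g

/-- Translation without change of sign: the complex with `i`-th cell `X^(i + a)` and with the
differentials of `X`. -/
@[simps]
def translate (a : ℤ) : CochainComplex V ℤ ⥤ CochainComplex V ℤ where
  obj X :=
    { X := fun i ↦ X.X (i + a)
      d := fun i j ↦ X.d (i + a) (j + a)
      shape := fun i j h ↦ X.shape _ _ (fun h' ↦ h (by
        simp only [ComplexShape.up_Rel] at h' ⊢; lia))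
      d_comp_d' := fun _ _ _ _ _ ↦ X.d_comp_d _ _ _ }
  map f := { f := fun i ↦ f.f (i + a), comm' := fun _ _ _ ↦ f.comm _ _ }

/-- The right inclusion `C_n ⥤ C_(n+1)`,
`(X^1 → ⋯ → X^n) ↦ (X^1 → ⋯ → X^n → 0)`. -/
def rightIncl (n : ℕ) : FixedSize V n ⥤ FixedSize V (n + 1) :=
  ObjectProperty.ιOfLE (fun X hX j hj ↦ hX j (by push_cast at hj; lia))

/-- The left inclusion `C_n ⥤ C_(n+1)`,
`(X^1 → ⋯ → X^n) ↦ (0 → X^1 → ⋯ → X^n)`. -/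
def leftIncl (n : ℕ) : FixedSize V n ⥤ FixedSize V (n + 1) :=
  ObjectProperty.lift _ ((IsFixedSize V n).ι ⋙ translate V (-1))
    (fun X j hj ↦ X.property (j + -1) (by push_cast at hj; lia))

section Truncation

variable [HasZeroObject V]

/-- The right abrupt truncation `C_(n+1) ⥤ C_n`,
`(X^1 → ⋯ → X^(n+1)) ↦ (X^1 → ⋯ → X^n)`. -/
noncomputable def rightTrunc (n : ℕ) : FixedSize V (n + 1) ⥤ FixedSize V n :=
  ObjectProperty.lift _
    ((IsFixedSize V (n + 1)).ι ⋙ (ComplexShape.embeddingUpIntLE (n : ℤ)).stupidTruncFunctor V)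
    (fun X j hj ↦ by
      by_cases h : (n : ℤ) < j
      · exact HomologicalComplex.isZero_stupidTrunc_X _ _ _
          (fun i ↦ by simp only [ComplexShape.embeddingUpIntLE_f]; lia)
      · obtain ⟨i, hi⟩ := Int.le.dest (not_lt.1 h)
        exact (X.property j (by lia)).of_iso
          (HomologicalComplex.stupidTruncXIso _ (ComplexShape.embeddingUpIntLE (n : ℤ))
            (i := i) (by simp only [ComplexShape.embeddingUpIntLE_f]; lia)))

/-- The left abrupt truncation `C_(n+1) ⥤ C_n`,
`(X^1 → ⋯ → X^(n+1)) ↦ (X^2 → ⋯ → X^(n+1))`. -/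
noncomputable def leftTrunc (n : ℕ) : FixedSize V (n + 1) ⥤ FixedSize V n :=
  ObjectProperty.lift _
    ((IsFixedSize V (n + 1)).ι ⋙ translate V 1 ⋙
      (ComplexShape.embeddingUpIntGE (1 : ℤ)).stupidTruncFunctor V)
    (fun X j hj ↦ by
      by_cases h : j < 1
      · exact HomologicalComplex.isZero_stupidTrunc_X _ _ _
          (fun i ↦ by simp only [ComplexShape.embeddingUpIntGE_f]; lia)
      · obtain ⟨i, hi⟩ := Int.le.dest (not_lt.1 h)
        exact (X.property (j + 1) (by push_cast; lia)).of_iso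
          (HomologicalComplex.stupidTruncXIso _ (ComplexShape.embeddingUpIntGE (1 : ℤ))
            (i := i) (by simp only [ComplexShape.embeddingUpIntGE_f]; lia)))

end Truncation

/-- The side, left or right, on which an inclusion or a truncation acts. -/
inductive Side
  | left
  | right

/-- The left or the right inclusion. -/
def incl (n : ℕ) : Side → (FixedSize V n ⥤ FixedSize V (n + 1))
  | .left => leftIncl V n
  | .right => rightIncl V n

/-- The left or the right abrupt truncation. -/
noncomputable def trunc [HasZeroObject V] (n : ℕ) :
    Side → (FixedSize V (n + 1) ⥤ FixedSize V n)
  | .left => leftTrunc V n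
  | .right => rightTrunc V n

/-- The `k`-fold iterated inclusion `C_n ⥤ C_(n+k)`: first on the side `w 0`, then on the
side `w 1`, and so on. -/
def iterIncl (n : ℕ) : (k : ℕ) → (Fin k → Side) → (FixedSize V n ⥤ FixedSize V (n + k))
  | 0, _ => 𝟭 _
  | k + 1, w => iterIncl n k (fun i ↦ w i.castSucc) ⋙ incl V (n + k) (w (Fin.last k))

/-- The `k`-fold iterated abrupt truncation `C_(n+k) ⥤ C_n`: first on the side `w (k - 1)`, and
so on down to the side `w 0`. -/
noncomputable def iterTrunc [HasZeroObject V] (n : ℕ) :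
    (k : ℕ) → (Fin k → Side) → (FixedSize V (n + k) ⥤ FixedSize V n)
  | 0, _ => 𝟭 _
  | k + 1, w => trunc V (n + k) (w (Fin.last k)) ⋙ iterTrunc n k (fun i ↦ w i.castSucc)

instance (n : ℕ) (s : Side) : (incl V n s).PreservesZeroMorphisms where
  map_zero X Y := by cases s <;> rfl

instance [HasZeroObject V] (n : ℕ) (s : Side) : (trunc V n s).PreservesZeroMorphisms where
  map_zero X Y := by
    cases s
    · ext1
      exact HomologicalComplex.extendMap_zero _ _ _
    · ext1
      exact HomologicalComplex.extendMap_zero _ _ _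

instance (n k : ℕ) (w : Fin k → Side) : (iterIncl V n k w).PreservesZeroMorphisms := by
  induction k with
  | zero => exact inferInstanceAs (𝟭 _).PreservesZeroMorphisms
  | succ k ih =>
    have := ih (fun i ↦ w i.castSucc)
    exact inferInstanceAs (_ ⋙ _ : _ ⥤ _).PreservesZeroMorphisms

instance [HasZeroObject V] (n k : ℕ) (w : Fin k → Side) :
    (iterTrunc V n k w).PreservesZeroMorphisms := by
  induction k with
  | zero => exact inferInstanceAs (𝟭 _).PreservesZeroMorphisms
  | succ k ih =>
    have := ih (fun i ↦ w i.castSucc)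
    exact inferInstanceAs (_ ⋙ _ : _ ⥤ _).PreservesZeroMorphisms

end FixedSize

/-! ### The bounded homotopy category and the length of a complex -/

section Homotopy

variable (V : Type u) [Category.{v} V] [Preadditive V]

/-- The bounded complexes. -/
def IsBounded : ObjectProperty (CochainComplex V ℤ) :=
  fun X ↦ ∃ r s : ℤ, ∀ j : ℤ, (j < r ∨ s < j) → IsZero (X.X j)

/-- The bounded homotopy category `K^b(V)`: the full subcategory of `K(V)` on the bounded
complexes. -/
abbrev Kb := ((IsBounded V).strictMap
  (HomotopyCategory.quotient V (ComplexShape.up ℤ))).FullSubcategory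

lemma IsBounded.biprod [HasBinaryBiproducts V] {X Y : CochainComplex V ℤ}
    (hX : IsBounded V X) (hY : IsBounded V Y) : IsBounded V (X ⊞ Y) := by
  obtain ⟨r₁, s₁, h₁⟩ := hX
  obtain ⟨r₂, s₂, h₂⟩ := hY
  refine ⟨min r₁ r₂, max s₁ s₂, fun j hj ↦ ?_⟩
  refine IsZero.of_iso ?_ ((HomologicalComplex.eval V (ComplexShape.up ℤ) j).mapBiprod X Y)
  rw [biprod_isZero_iff]
  exact ⟨h₁ j (by lia), h₂ j (by lia)⟩

instance [HasBinaryBiproducts V] : HasBinaryBiproducts (Kb V) where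
  has_binary_biproduct := by
    rintro ⟨_, ⟨X, hX⟩⟩ ⟨_, ⟨Y, hY⟩⟩
    let F : (IsBounded V).FullSubcategory ⥤ Kb V :=
      ObjectProperty.lift _ ((IsBounded V).ι ⋙ HomotopyCategory.quotient V (ComplexShape.up ℤ))
        (fun Z ↦ ⟨_, Z.property⟩)
    have : F.Additive := ⟨rfl⟩
    let X' : (IsBounded V).FullSubcategory := ⟨X, hX⟩
    let Y' : (IsBounded V).FullSubcategory := ⟨Y, hY⟩
    let b : BinaryBicone X' Y' :=
      { pt := ⟨X ⊞ Y, hX.biprod V hY⟩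
        fst := ObjectProperty.homMk biprod.fst
        snd := ObjectProperty.homMk biprod.snd
        inl := ObjectProperty.homMk biprod.inl
        inr := ObjectProperty.homMk biprod.inr }
    have hb : b.IsBilimit := isBinaryBilimitOfTotal _ (by ext1; exact biprod.total)
    have := preservesBinaryBiproducts_of_preservesBiproducts F
    exact ⟨⟨⟨_, isBinaryBilimitOfPreserves F hb⟩⟩⟩

variable {V}

/-- The complex `M` has no nonzero contractible direct summand. Among bounded complexes of
projective modules the contractible ones are the projective ones: the direct sums of complexes
`⋯ → 0 → P = P → 0 → ⋯`. -/
def HasNoContractibleSummand [HasBinaryBiproducts V] (M : CochainComplex V ℤ) : Prop :=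
  ∀ N N' : CochainComplex V ℤ, Nonempty (M ≅ N ⊞ N') → Nonempty (Homotopy (𝟙 N) 0) → IsZero N

/-- The object `X` of `K^b(V)` has length `l`: it has a representative `M` without
nonzero contractible direct summands such that `M^r ≠ 0`, `M^s ≠ 0`, `M^j = 0` for `j ∉ [r, s]`,
and `l = s - r`. -/
def HasLength [HasBinaryBiproducts V] (X : Kb V) (l : ℕ) : Prop :=
  ∃ (M : CochainComplex V ℤ) (r s : ℤ),
    Nonempty ((HomotopyCategory.quotient V (ComplexShape.up ℤ)).obj M ≅ X.obj) ∧
    HasNoContractibleSummand M ∧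
    ¬ IsZero (M.X r) ∧ ¬ IsZero (M.X s) ∧
    (∀ j : ℤ, (j < r ∨ s < j) → IsZero (M.X j)) ∧
    (l : ℤ) = s - r

end Homotopy

/-! ### Projective modules and the strong global dimension -/

section Algebra

variable (Λ : Type u) [Ring Λ]

/-- A right `Λ`-module, that is a left module over the opposite ring, is finitely generated and
projective. -/
def IsFGProjective : ObjectProperty (ModuleCat.{u} Λᵐᵒᵖ) :=
  fun M ↦ Module.Finite Λᵐᵒᵖ M ∧ Module.Projective Λᵐᵒᵖ M

/-- The category `proj Λ` of finitely generated projective right `Λ`-modules. -/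
abbrev Proj := (IsFGProjective Λ).FullSubcategory

instance : (IsFGProjective Λ).IsClosedUnderFiniteProducts where
  isClosedUnderLimitsOfShape J _ :=
    { limitsOfShape_le := by
        rintro M ⟨p⟩
        let N : J → ModuleCat.{u} Λᵐᵒᵖ := fun j ↦ p.diag.obj ⟨j⟩
        have hN (j : J) : IsFGProjective Λ (N j) := p.prop_diag_obj ⟨j⟩
        have (j : J) : Module.Finite Λᵐᵒᵖ (N j) := (hN j).1
        have (j : J) : Module.Projective Λᵐᵒᵖ (N j) := (hN j).2
        let e : M ≅ ModuleCat.of Λᵐᵒᵖ (∀ j, N j) :=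
          IsLimit.conePointsIsoOfNatIso p.isLimit (ModuleCat.productConeIsLimit N)
            Discrete.natIsoFunctor
        have : Finite J := inferInstance
        have : Fintype J := Fintype.ofFinite J
        have : Module.Projective Λᵐᵒᵖ (∀ j, N j) := by
          classical
          exact Module.Projective.of_equiv
            (DirectSum.linearEquivFunOnFintype Λᵐᵒᵖ J (fun j ↦ N j))
        exact ⟨Module.Finite.equiv e.symm.toLinearEquiv,
          Module.Projective.of_equiv e.symm.toLinearEquiv⟩ }

instance : HasBinaryBiproducts (Proj Λ) :=
  HasBinaryBiproducts.of_hasBinaryProducts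

instance : HasZeroObject (Proj Λ) :=
  have : HasFiniteBiproducts (Proj Λ) := HasFiniteBiproducts.of_hasFiniteProducts
  inferInstance

/-- The strong global dimension of `Λ`: the supremum of the lengths of the indecomposable objects
of `K^b(proj Λ)`. -/
noncomputable def strongGlobalDimension : ℕ∞ :=
  sSup {d : ℕ∞ | ∃ (X : Kb (Proj Λ)) (l : ℕ), Indecomposable X ∧ HasLength X l ∧ d = l}

end Algebra

end CnProj

open CnProj

/-! The core is a window principle: an indecomposable bounded complex over `proj Λ` lives in at most
`η + 1` consecutive degrees. A non-contractible one is its own minimal representative in `K^b`, so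
its length is at most `η`; a contractible one occupies two degrees, which is where `η ≥ 1` enters
(`vanishAbove_of_indecomposable`). Splitting into indecomposables, a bounded complex vanishing below
degree `p` is `A ⊕ B` with `A` in degrees `p, …, p + η` and `B` vanishing in degree `p` as well
(`isLengthBounded`).

The engine is `IsLengthBounded.exists_factorization`: a morphism from an object `X` with local
endomorphism ring, into a complex that vanishes up to the lowest degree of `X`, factors through a
non-section `X ⟶ U` with `U` in the window of `η + 1` degrees starting there. `U` is cut out of an
extension of the part of the mapping cone that meets its lowest degree by `X`.

Let `m ≥ η + 1`. Inclusions are fully faithful, so they reflect irreducible and almost split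
morphisms; to preserve them, the new test objects of `C_(m+1)` must be controlled. If `X^1 = 0`, the
left inclusion works, by its coreflection. If `X^1 ≠ 0`, the right inclusion works: a test object
splits as `A ⊕ B` with `A` in `C_m`, and the component into `B` is replaced by its factorization
through `U` in `C_m` (`IsIrreducible.exists_incl`, `IsAlmostSplitSequence.exists_incl`). Conversely,
the factorization and a quotient truncation force both ends of an irreducible morphism or almost
split sequence of `C_(m+1)` into a common window, so that they vanish in degree `1` or `m + 1` and
come from `C_m` (`IsIrreducible.exists_side`, `IsAlmostSplitSequence.exists_side`). Induction on the
number of steps gives the words `w`. -/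

namespace CnProj

/-! ### Fully faithful functors, isomorphisms and local endomorphism rings -/

section Reflect

variable {C D : Type*} [Category* C] [Category* D]

lemma isSplitMono_iso_comp_iff {X X' Y Y' : C} (a : X ≅ X') (b : Y ≅ Y') {f : X ⟶ Y} {f' : X' ⟶ Y'}
    (w : a.hom ≫ f' = f ≫ b.hom) : IsSplitMono f ↔ IsSplitMono f' := by
  refine ⟨fun h ↦ ⟨⟨⟨b.inv ≫ retraction f ≫ a.hom, ?_⟩⟩⟩,
    fun h ↦ ⟨⟨⟨b.hom ≫ retraction f' ≫ a.inv, ?_⟩⟩⟩⟩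
  · have : f' = a.inv ≫ f ≫ b.hom := by rw [← w, Iso.inv_hom_id_assoc]
    simp [this]
  · rw [← reassoc_of% w]
    simp

lemma isSplitEpi_iso_comp_iff {X X' Y Y' : C} (a : X ≅ X') (b : Y ≅ Y') {f : X ⟶ Y} {f' : X' ⟶ Y'}
    (w : a.hom ≫ f' = f ≫ b.hom) : IsSplitEpi f ↔ IsSplitEpi f' := by
  refine ⟨fun h ↦ ⟨⟨⟨b.inv ≫ section_ f ≫ a.hom, ?_⟩⟩⟩,
    fun h ↦ ⟨⟨⟨b.hom ≫ section_ f' ≫ a.inv, ?_⟩⟩⟩⟩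
  · simp [w]
  · have : f = a.hom ≫ f' ≫ b.inv := by rw [reassoc_of% w, Iso.hom_inv_id, Category.comp_id]
    simp [this]

lemma IsIrreducible.of_iso {X X' Y Y' : C} (a : X ≅ X') (b : Y ≅ Y') {f : X ⟶ Y} {f' : X' ⟶ Y'}
    (w : a.hom ≫ f' = f ≫ b.hom) (h : IsIrreducible f) : IsIrreducible f' where
  not_section := by rw [← isSplitMono_iso_comp_iff a b w]; exact h.not_section
  not_retraction := by rw [← isSplitEpi_iso_comp_iff a b w]; exact h.not_retraction
  factor Z g k hgk := by
    have := h.factor Z (a.hom ≫ g) (k ≫ b.inv) (by simp [reassoc_of% hgk, reassoc_of% w])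
    refine this.imp (fun h' ↦ ?_) (fun h' ↦ ?_)
    · exact (isSplitMono_iso_comp_iff a (Iso.refl _) (by simp)).1 h'
    · exact (isSplitEpi_iso_comp_iff (Iso.refl _) b (by simp)).1 h'

/-- Reflection is formal: the test objects of `C` are among those of `D`. Preservation is not, since
`D` has more test objects; it is the real content of the theorem. -/
lemma IsIrreducible.of_map (F : C ⥤ D) [F.Full] [F.Faithful] {X Y : C} {f : X ⟶ Y}
    (h : IsIrreducible (F.map f)) : IsIrreducible f where
  not_section h' := h.not_section inferInstance
  not_retraction h' := h.not_retraction inferInstance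
  factor Z g k hgk := by
    simpa only [Functor.isSplitMono_iff, Functor.isSplitEpi_iff] using
      h.factor (F.obj Z) (F.map g) (F.map k) (by rw [← F.map_comp, hgk])

lemma IsRightAlmostSplit.of_map (F : C ⥤ D) [F.Full] [F.Faithful] {X Y : C} {f : X ⟶ Y}
    (h : IsRightAlmostSplit (F.map f)) : IsRightAlmostSplit f where
  not_retraction h' := h.not_retraction inferInstance
  factor Z g hg := by
    obtain ⟨s, hs⟩ := h.factor _ (F.map g) (by rwa [Functor.isSplitEpi_iff])
    exact ⟨F.preimage s, F.map_injective (by simpa using hs)⟩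

lemma IsLeftAlmostSplit.of_map (F : C ⥤ D) [F.Full] [F.Faithful] {X Y : C} {f : X ⟶ Y}
    (h : IsLeftAlmostSplit (F.map f)) : IsLeftAlmostSplit f where
  not_section h' := h.not_section inferInstance
  factor Z g hg := by
    obtain ⟨s, hs⟩ := h.factor _ (F.map g) (by rwa [Functor.isSplitMono_iff])
    exact ⟨F.preimage s, F.map_injective (by simpa using hs)⟩

lemma isMinimalRight_map_iff (F : C ⥤ D) [F.Full] [F.Faithful] {X Y : C} {f : X ⟶ Y} :
    IsMinimalRight (F.map f) ↔ IsMinimalRight f := by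
  refine ⟨fun h u hu ↦ ?_, fun h u hu ↦ ?_⟩
  · have := h (F.map u) (by rw [← F.map_comp, hu])
    exact isIso_of_fully_faithful F u
  · have := h (F.preimage u) (F.map_injective (by simpa using hu))
    rw [← F.map_preimage u]
    infer_instance

lemma isMinimalLeft_map_iff (F : C ⥤ D) [F.Full] [F.Faithful] {X Y : C} {f : X ⟶ Y} :
    IsMinimalLeft (F.map f) ↔ IsMinimalLeft f := by
  refine ⟨fun h u hu ↦ ?_, fun h u hu ↦ ?_⟩
  · have := h (F.map u) (by rw [← F.map_comp, hu])
    exact isIso_of_fully_faithful F u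
  · have := h (F.preimage u) (F.map_injective (by simpa using hu))
    rw [← F.map_preimage u]
    infer_instance

lemma IsRightAlmostSplit.of_iso {X X' Y Y' : C} (a : X ≅ X') (b : Y ≅ Y') {f : X ⟶ Y}
    {f' : X' ⟶ Y'} (w : a.hom ≫ f' = f ≫ b.hom) (h : IsRightAlmostSplit f) :
    IsRightAlmostSplit f' where
  not_retraction := by rw [← isSplitEpi_iso_comp_iff a b w]; exact h.not_retraction
  factor Z g hg := by
    obtain ⟨s, hs⟩ := h.factor Z (g ≫ b.inv) (by
      rwa [isSplitEpi_iso_comp_iff (Iso.refl _) b (f' := g) (by simp)])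
    exact ⟨s ≫ a.hom, by simp [w, reassoc_of% hs]⟩

lemma IsLeftAlmostSplit.of_iso {X X' Y Y' : C} (a : X ≅ X') (b : Y ≅ Y') {f : X ⟶ Y}
    {f' : X' ⟶ Y'} (w : a.hom ≫ f' = f ≫ b.hom) (h : IsLeftAlmostSplit f) :
    IsLeftAlmostSplit f' where
  not_section := by rw [← isSplitMono_iso_comp_iff a b w]; exact h.not_section
  factor Z g hg := by
    obtain ⟨s, hs⟩ := h.factor Z (a.hom ≫ g) (by
      rwa [isSplitMono_iso_comp_iff a (Iso.refl _) (f' := g) (by simp)])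
    refine ⟨b.inv ≫ s, ?_⟩
    rw [← cancel_epi a.hom, reassoc_of% w]
    simpa using hs

lemma IsMinimalRight.of_iso {X X' Y Y' : C} (a : X ≅ X') (b : Y ≅ Y') {f : X ⟶ Y}
    {f' : X' ⟶ Y'} (w : a.hom ≫ f' = f ≫ b.hom) (h : IsMinimalRight f) : IsMinimalRight f' := by
  intro u hu
  have := h (a.hom ≫ u ≫ a.inv) (by
    rw [← cancel_mono b.hom]
    simp only [Category.assoc, ← w, Iso.inv_hom_id_assoc, hu])
  have : u = a.inv ≫ (a.hom ≫ u ≫ a.inv) ≫ a.hom := by simp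
  rw [this]
  infer_instance

lemma IsMinimalLeft.of_iso {X X' Y Y' : C} (a : X ≅ X') (b : Y ≅ Y') {f : X ⟶ Y}
    {f' : X' ⟶ Y'} (w : a.hom ≫ f' = f ≫ b.hom) (h : IsMinimalLeft f) : IsMinimalLeft f' := by
  intro u hu
  have := h (b.hom ≫ u ≫ b.inv) (by
    rw [← reassoc_of% w, reassoc_of% hu, reassoc_of% w, Iso.hom_inv_id, Category.comp_id])
  have : u = b.inv ≫ (b.hom ≫ u ≫ b.inv) ≫ b.hom := by simp
  rw [this]
  infer_instance

end Reflect

/-! ### Fitting's lemma and local endomorphism rings. -/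

section Fitting

variable {C : Type*} [Category* C] [Preadditive C]

/-- Every endomorphism of `X` is an automorphism or nilpotent. -/
def IsFitting (X : C) : Prop := ∀ φ : End X, IsUnit φ ∨ IsNilpotent φ

lemma IsFitting.isIso_or {X : C} (hX : IsFitting X) {φ ψ : X ⟶ X} (h : φ + ψ = 𝟙 X) :
    IsIso φ ∨ IsIso ψ := by
  rcases hX φ with h' | h'
  · exact Or.inl ((isUnit_iff_isIso _).1 h')
  · right
    have h₂ := h'.isUnit_one_sub
    rwa [show (1 : End X) - (show End X from φ) = (show End X from ψ) from
      sub_eq_iff_eq_add'.2 h.symm, isUnit_iff_isIso] at h₂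

/-- Locality in the form used later: a section into a direct sum has a component that is already a
section. -/
lemma IsFitting.isSplitMono_or {X Y Z : C} (hX : IsFitting X) {a : X ⟶ Y} {b : X ⟶ Z}
    {r : Y ⟶ X} {s : Z ⟶ X} (h : a ≫ r + b ≫ s = 𝟙 X) : IsSplitMono a ∨ IsSplitMono b := by
  rcases hX.isIso_or h with h' | h'
  · exact Or.inl ⟨⟨⟨r ≫ inv (a ≫ r), by rw [← Category.assoc, IsIso.hom_inv_id]⟩⟩⟩
  · exact Or.inr ⟨⟨⟨s ≫ inv (b ≫ s), by rw [← Category.assoc, IsIso.hom_inv_id]⟩⟩⟩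

lemma IsFitting.eq_zero_or_eq_id {X : C} (hX : IsFitting X) {e : X ⟶ X} (he : e ≫ e = e) :
    e = 0 ∨ e = 𝟙 X := by
  rcases hX e with h | ⟨n, hn⟩
  · right
    have := (isUnit_iff_isIso _).1 h
    rw [← cancel_mono e, he, Category.id_comp]
  · left
    have he' : IsIdempotentElem (show End X from e) := he
    have h1 : (show End X from e) ^ (n + 1) = 0 := by rw [pow_succ, hn, zero_mul]
    rwa [he'.pow_succ_eq] at h1

lemma IsFitting.of_map {D : Type*} [Category* D] [Preadditive D] (F : C ⥤ D) [F.Full] [F.Faithful]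
    [F.PreservesZeroMorphisms] {X : C} (h : IsFitting (F.obj X)) : IsFitting X := by
  intro φ
  rcases h (F.map φ) with h | ⟨n, hn⟩
  · left
    have := (isUnit_iff_isIso _).1 h
    exact (isUnit_iff_isIso _).2 (isIso_of_fully_faithful F φ)
  · right
    refine ⟨n, F.map_injective ?_⟩
    have := map_pow (F.mapEnd X) φ n
    rw [F.map_zero]
    exact this.trans hn

/-- Faithfulness is not required, so that this applies to the quotient functor to the homotopy
category. -/
lemma IsFitting.map {D : Type*} [Category* D] [Preadditive D] (F : C ⥤ D) [F.Full]
    [F.PreservesZeroMorphisms] {X : C} (h : IsFitting X) : IsFitting (F.obj X) := by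
  intro φ
  obtain ⟨φ, rfl⟩ := F.map_surjective φ
  rcases h φ with h | ⟨n, hn⟩
  · left
    have := (isUnit_iff_isIso _).1 h
    exact (isUnit_iff_isIso _).2 (inferInstanceAs (IsIso (F.map φ)))
  · right
    refine ⟨n, ?_⟩
    have := map_pow (F.mapEnd X) (show End X from φ) n
    exact this.symm.trans ((congrArg F.map hn).trans (F.map_zero _ _))

/-- A decomposition of an object given by complementary idempotents. -/
lemma nonempty_iso_biprod [HasBinaryBiproducts C] {X Y Z : C} {i : Y ⟶ X} {p : X ⟶ Y} {j : Z ⟶ X}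
    {q : X ⟶ Z} (hip : i ≫ p = 𝟙 Y) (hjq : j ≫ q = 𝟙 Z) (h : p ≫ i + q ≫ j = 𝟙 X) :
    Nonempty (X ≅ Y ⊞ Z) := by
  have hpiq : p ≫ i ≫ q = 0 := by
    have := congrArg (· ≫ q) h
    simpa [hjq] using this
  have hiq : i ≫ q = 0 := by
    have := congrArg (i ≫ ·) hpiq
    simpa [reassoc_of% hip] using this
  have hqjp : q ≫ j ≫ p = 0 := by
    have := congrArg (· ≫ p) h
    simpa [hip] using this
  have hjp : j ≫ p = 0 := by
    have := congrArg (j ≫ ·) hqjp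
    simpa [reassoc_of% hjq] using this
  exact ⟨biprod.lift p q, biprod.desc i j, by simpa using h,
    by ext <;> simp [hip, hiq, hjp, hjq]⟩

lemma IsFitting.indecomposable [HasBinaryBiproducts C] {X : C} (hX : IsFitting X)
    (h0 : ¬ IsZero X) : Indecomposable X := by
  refine ⟨h0, fun Y Z e ↦ ?_⟩
  have key : (e.hom ≫ biprod.fst ≫ biprod.inl ≫ e.inv) +
      (e.hom ≫ biprod.snd ≫ biprod.inr ≫ e.inv) = 𝟙 X := by
    have := congrArg (fun t ↦ e.hom ≫ t ≫ e.inv) (biprod.total (X := Y) (Y := Z))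
    simpa only [Preadditive.add_comp, Preadditive.comp_add, Category.assoc, Category.id_comp,
      Iso.hom_inv_id] using this
  rcases hX.eq_zero_or_eq_id (e := e.hom ≫ biprod.fst ≫ biprod.inl ≫ e.inv) (by simp) with h | h
  · left
    rw [IsZero.iff_id_eq_zero]
    have := congrArg (fun t ↦ biprod.inl ≫ e.inv ≫ t ≫ e.hom ≫ biprod.fst) h
    simpa using this
  · right
    rw [h, add_eq_left] at key
    rw [IsZero.iff_id_eq_zero]
    have := congrArg (fun t ↦ biprod.inr ≫ e.inv ≫ t ≫ e.hom ≫ biprod.snd) key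
    simpa using this

/-- Fitting's lemma. Writing an annihilating polynomial as `X^n Q` with `Q(0) ≠ 0` makes `φ`
invertible on the image of `φ^n`; the projection `e = φ^n c^n` onto this image is a split
idempotent, hence `0` (then `φ^n = 0`) or `1` (then `φ` is invertible). -/
lemma isFitting_of_indecomposable [HasBinaryBiproducts C] [IsIdempotentComplete C]
    (K : Type*) [Field K] [Linear K C] {X : C} [Module.Finite K (End X)]
    (hX : Indecomposable X) : IsFitting X := by
  intro φ
  obtain ⟨P, hP, hφ⟩ : ∃ P : Polynomial K, P ≠ 0 ∧ Polynomial.aeval φ P = 0 :=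
    ⟨minpoly K φ, minpoly.ne_zero (Algebra.IsIntegral.isIntegral φ), minpoly.aeval K φ⟩
  obtain ⟨Q, hQ, hQ0⟩ := Polynomial.exists_eq_pow_rootMultiplicity_mul_and_not_dvd P hP 0
  set n := P.rootMultiplicity 0
  rw [Polynomial.C_0, sub_zero] at hQ hQ0
  rw [Polynomial.X_dvd_iff] at hQ0
  obtain ⟨c, hc⟩ : ∃ c : End X, φ ^ n = φ ^ (n + 1) * c ∧ Commute φ c := by
    -- From `φ^n Q(φ) = 0` and `Q = X * Q.divX + Q(0)`, solve for `φ^n Q(0)` and divide by `Q(0)`.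
    refine ⟨Polynomial.aeval φ (Polynomial.C (-(Q.coeff 0)⁻¹) * Q.divX), ?_, ?_⟩
    · have h1 : φ ^ n * Polynomial.aeval φ Q = 0 := by
        rw [hQ] at hφ
        simpa using hφ
      rw [← Polynomial.X_mul_divX_add Q] at h1
      simp only [map_add, map_mul, Polynomial.aeval_X, Polynomial.aeval_C, mul_add] at h1
      have h2 : φ ^ n * algebraMap K (End X) (Q.coeff 0) =
          - (φ ^ n * (φ * Polynomial.aeval φ Q.divX)) := by
        rw [eq_neg_iff_add_eq_zero, add_comm, h1]
      have h3 : algebraMap K (End X) (Q.coeff 0) * algebraMap K (End X) (Q.coeff 0)⁻¹ = 1 := by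
        rw [← map_mul, mul_inv_cancel₀ hQ0, map_one]
      calc φ ^ n = φ ^ n * algebraMap K (End X) (Q.coeff 0) *
            algebraMap K (End X) (Q.coeff 0)⁻¹ := by rw [mul_assoc, h3, mul_one]
        _ = _ := by
          rw [h2]
          simp only [map_mul, Polynomial.aeval_C, map_neg, pow_succ]
          rw [neg_mul, mul_assoc, mul_assoc, mul_assoc, ← Algebra.commutes]
          simp
    · simpa using (Commute.all Polynomial.X
        (Polynomial.C (-(Q.coeff 0)⁻¹) * Q.divX)).map (Polynomial.aeval φ)
  obtain ⟨hc, hcomm⟩ := hc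
  have hpow (m : ℕ) : φ ^ n = φ ^ (n + m) * c ^ m := by
    induction m with
    | zero => simp
    | succ m ih =>
      have : φ ^ (n + m) = φ ^ (n + (m + 1)) * c := by
        rw [add_comm n m, pow_add, hc, ← mul_assoc, ← pow_add]
        congr 2
        lia
      rw [ih, this, pow_succ', mul_assoc]
  set e : End X := φ ^ n * c ^ n with he_def
  have hcn : Commute (φ ^ n) (c ^ n) := hcomm.pow_pow n n
  have he : e * e = e := by
    calc e * e = (φ ^ (n + n) * c ^ n) * c ^ n := by
          rw [he_def, mul_assoc, ← mul_assoc (c ^ n), ← hcn.eq, mul_assoc (φ ^ n), ← mul_assoc (φ ^ n) (φ ^ n), ← pow_add, ← mul_assoc]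
      _ = e := by rw [← hpow]
  have heφ : φ ^ n * e = φ ^ n := by rw [he_def, ← mul_assoc, ← pow_add, ← hpow]
  obtain ⟨Y, i, p, hip, hpi⟩ := IsIdempotentComplete.idempotents_split X e he
  obtain ⟨Z, j, q, hjq, hqj⟩ := IsIdempotentComplete.idempotents_split X (𝟙 X - (show X ⟶ X from e))
    (Idempotents.idem_of_id_sub_idem _ he)
  obtain ⟨e'⟩ := nonempty_iso_biprod hip hjq (by rw [hpi, hqj]; exact add_sub_cancel _ _)
  rcases hX.2 Y Z e' with h | h
  · right
    have h0 : e = 0 := by rw [← hpi, h.eq_of_src i 0, comp_zero]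
    exact ⟨n, by rw [← heφ, h0, mul_zero]⟩
  · left
    have h0 : e = 1 := by
      have : 𝟙 X - (show X ⟶ X from e) = 0 := by rw [← hqj, h.eq_of_src j 0, comp_zero]
      exact (sub_eq_zero.1 this).symm
    by_cases hn : n = 0
    · rw [hn] at hc
      have hc' : φ * c = 1 := by simpa using hc.symm
      exact ⟨⟨φ, c, hc', by rw [← hcomm.eq, hc']⟩, rfl⟩
    · refine (Commute.isUnit_mul_iff (b := φ ^ (n - 1) * c ^ n)
        (((Commute.refl φ).pow_right _).mul_right (hcomm.pow_right _))).1 ?_ |>.1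
      rw [← mul_assoc, ← pow_succ', Nat.sub_add_cancel (Nat.one_le_iff_ne_zero.2 hn), ← he_def, h0]
      exact isUnit_one

end Fitting

/-! ### Decompositions, truncations and twisted sums of complexes -/

/-- A decomposition of `Z` as a direct sum of `A` and `B`. -/
structure Decomp {C : Type*} [Category* C] [Preadditive C] (Z A B : C) where
  /-- the inclusion of the first summand -/
  i : A ⟶ Z
  /-- the projection to the first summand -/
  p : Z ⟶ A
  /-- the inclusion of the second summand -/
  j : B ⟶ Z
  /-- the projection to the second summand -/
  q : Z ⟶ B
  i_p : i ≫ p = 𝟙 A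
  j_q : j ≫ q = 𝟙 B
  total : p ≫ i + q ≫ j = 𝟙 Z

namespace Decomp

section

variable {C : Type*} [Category* C] [Preadditive C]

/-- The decomposition given by a biproduct. -/
noncomputable def ofIso [HasBinaryBiproducts C] {Z A B : C} (e : Z ≅ A ⊞ B) : Decomp Z A B where
  i := biprod.inl ≫ e.inv
  p := e.hom ≫ biprod.fst
  j := biprod.inr ≫ e.inv
  q := e.hom ≫ biprod.snd
  i_p := by simp
  j_q := by simp
  total := by
    have := congrArg (fun t ↦ e.hom ≫ t ≫ e.inv) (biprod.total (X := A) (Y := B))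
    simpa only [Preadditive.add_comp, Preadditive.comp_add, Category.assoc, Category.id_comp,
      Iso.hom_inv_id] using this

/-- The decomposition with second summand zero. -/
def left (Z : C) {O : C} (hO : IsZero O) : Decomp Z Z O where
  i := 𝟙 Z
  p := 𝟙 Z
  j := 0
  q := 0
  i_p := by simp
  j_q := hO.eq_of_src _ _
  total := by simp

/-- The decomposition with first summand zero. -/
def right (Z : C) {O : C} (hO : IsZero O) : Decomp Z O Z where
  i := 0
  p := 0
  j := 𝟙 Z
  q := 𝟙 Z
  i_p := hO.eq_of_src _ _
  j_q := by simp
  total := by simp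

variable {Z A B : C} (D : Decomp Z A B)

lemma i_q : D.i ≫ D.q = 0 := by
  have h := congrArg (fun t ↦ D.i ≫ t ≫ D.q) D.total
  simpa [reassoc_of% D.i_p, D.j_q] using h

lemma j_p : D.j ≫ D.p = 0 := by
  have h := congrArg (fun t ↦ D.j ≫ t ≫ D.p) D.total
  simpa [D.i_p, reassoc_of% D.j_q] using h

/-- The decomposition assembled from decompositions of the two summands. -/
noncomputable def trans [HasBinaryBiproducts C] {A₁ B₁ A₂ B₂ : C} (D₁ : Decomp A A₁ B₁)
    (D₂ : Decomp B A₂ B₂) : Decomp Z (A₁ ⊞ A₂) (B₁ ⊞ B₂) where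
  i := biprod.desc (D₁.i ≫ D.i) (D₂.i ≫ D.j)
  p := biprod.lift (D.p ≫ D₁.p) (D.q ≫ D₂.p)
  j := biprod.desc (D₁.j ≫ D.i) (D₂.j ≫ D.j)
  q := biprod.lift (D.p ≫ D₁.q) (D.q ≫ D₂.q)
  i_p := by ext <;> simp [reassoc_of% D.i_p, reassoc_of% D.j_q, reassoc_of% D.i_q, reassoc_of% D.j_p, D₁.i_p, D₂.i_p]
  j_q := by ext <;> simp [reassoc_of% D.i_p, reassoc_of% D.j_q, reassoc_of% D.i_q, reassoc_of% D.j_p, D₁.j_q, D₂.j_q]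
  total := by
    have h₁ : D.p ≫ (D₁.p ≫ D₁.i + D₁.q ≫ D₁.j) ≫ D.i = D.p ≫ D.i := by simp [D₁.total]
    have h₂ : D.q ≫ (D₂.p ≫ D₂.i + D₂.q ≫ D₂.j) ≫ D.j = D.q ≫ D.j := by simp [D₂.total]
    rw [← D.total, ← h₁, ← h₂]
    simp
    abel

end

end Decomp

lemma isZero_of_retract {C : Type*} [Category* C] [HasZeroMorphisms C] {X Y : C} (i : Y ⟶ X)
    (p : X ⟶ Y) (h : i ≫ p = 𝟙 Y) (hX : IsZero X) : IsZero Y := by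
  rw [IsZero.iff_id_eq_zero, ← h, hX.eq_of_tgt i 0, zero_comp]

section Complexes

open scoped ZeroObject

variable {V : Type u} [Category.{v} V] [Preadditive V]

/-- The cells of `Z` in degrees less than `p` are zero. -/
def VanishBelow (p : ℤ) (Z : CochainComplex V ℤ) : Prop := ∀ j, j < p → IsZero (Z.X j)

/-- The cells of `Z` in degrees greater than `q` are zero. -/
def VanishAbove (q : ℤ) (Z : CochainComplex V ℤ) : Prop := ∀ j, q < j → IsZero (Z.X j)

lemma VanishBelow.mono {p p' : ℤ} {Z : CochainComplex V ℤ} (h : VanishBelow p Z) (hp : p' ≤ p) :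
    VanishBelow p' Z := fun j hj ↦ h j (by lia)

lemma VanishAbove.mono {q q' : ℤ} {Z : CochainComplex V ℤ} (h : VanishAbove q Z) (hq : q ≤ q') :
    VanishAbove q' Z := fun j hj ↦ h j (by lia)

lemma isZero_X_of_retract {X Y : CochainComplex V ℤ} {i : Y ⟶ X} {p : X ⟶ Y} (h : i ≫ p = 𝟙 Y)
    {j : ℤ} (hX : IsZero (X.X j)) : IsZero (Y.X j) :=
  isZero_of_retract (i.f j) (p.f j) (by rw [← HomologicalComplex.comp_f, h]; rfl) hX

lemma VanishBelow.of_retract {X Y : CochainComplex V ℤ} {i : Y ⟶ X} {p : X ⟶ Y} (h : i ≫ p = 𝟙 Y)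
    {a : ℤ} (hX : VanishBelow a X) : VanishBelow a Y :=
  fun j hj ↦ isZero_X_of_retract h (hX j hj)

lemma VanishAbove.of_retract {X Y : CochainComplex V ℤ} {i : Y ⟶ X} {p : X ⟶ Y} (h : i ≫ p = 𝟙 Y)
    {a : ℤ} (hX : VanishAbove a X) : VanishAbove a Y :=
  fun j hj ↦ isZero_X_of_retract h (hX j hj)

lemma isZero_complex_of_X {X : CochainComplex V ℤ} (h : ∀ j, IsZero (X.X j)) : IsZero X := by
  rw [IsZero.iff_id_eq_zero]
  ext j
  exact (h j).eq_of_src _ _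

lemma Decomp.isZero_X {Z A B : CochainComplex V ℤ} (D : Decomp Z A B) {j : ℤ}
    (hA : IsZero (A.X j)) (hB : IsZero (B.X j)) : IsZero (Z.X j) := by
  rw [IsZero.iff_id_eq_zero]
  have := congrArg (fun t ↦ HomologicalComplex.Hom.f t j) D.total
  simp only [HomologicalComplex.add_f_apply, HomologicalComplex.comp_f,
    HomologicalComplex.id_f] at this
  rw [← this, hA.eq_of_tgt (D.p.f j) 0, hB.eq_of_tgt (D.q.f j) 0]
  simp

instance [HasBinaryBiproducts V] : HasBinaryBiproducts (CochainComplex V ℤ) :=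
  ⟨fun _ _ ↦ inferInstance⟩

lemma biprod_isZero_X [HasBinaryBiproducts V] {A B : CochainComplex V ℤ} {j : ℤ}
    (hA : IsZero (A.X j)) (hB : IsZero (B.X j)) : IsZero ((A ⊞ B).X j) :=
  (Decomp.ofIso (Iso.refl (A ⊞ B))).isZero_X hA hB

/-- The subcomplex of the cells in degrees at least `a`. -/
lemma exists_subcomplex [HasZeroObject V] (Z : CochainComplex V ℤ) (a : ℤ) :
    ∃ (T : CochainComplex V ℤ) (ι : T ⟶ Z), VanishBelow a T ∧ ∀ j, a ≤ j → IsIso (ι.f j) := by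
  have (j : ℤ) : ∃ (T : V) (m : T ⟶ Z.X j) (r : Z.X j ⟶ T), m ≫ r = 𝟙 T ∧
      (a ≤ j → r ≫ m = 𝟙 _) ∧ (j < a → IsZero T) := by
    by_cases h : a ≤ j
    · exact ⟨Z.X j, 𝟙 _, 𝟙 _, by simp, by simp, fun h' ↦ by lia⟩
    · exact ⟨0, 0, 0, (isZero_zero V).eq_of_src _ _, fun h' ↦ by lia, fun _ ↦ isZero_zero V⟩
  choose T m r h₁ h₂ h₃ using this
  have key (i j : ℤ) : (m i ≫ Z.d i j ≫ r j) ≫ m j = m i ≫ Z.d i j := by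
    by_cases hij : i + 1 = j
    · by_cases hi : i < a
      · exact (h₃ i hi).eq_of_src _ _
      · simp [h₂ j (by lia)]
    · simp [Z.shape i j hij]
  refine ⟨{ X := T, d := fun i j ↦ m i ≫ Z.d i j ≫ r j
            shape := fun i j h ↦ by simp [Z.shape i j h]
            d_comp_d' := fun i j k _ _ ↦ by simp [reassoc_of% key i j] },
    { f := m, comm' := fun i j _ ↦ (key i j).symm }, fun j hj ↦ h₃ j hj,
    fun j hj ↦ ⟨r j, h₁ j, h₂ j hj⟩⟩

/-- The quotient complex of the cells in degrees at most `a`. -/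
lemma exists_quotient [HasZeroObject V] (Z : CochainComplex V ℤ) (a : ℤ) :
    ∃ (T : CochainComplex V ℤ) (π : Z ⟶ T), VanishAbove a T ∧ ∀ j, j ≤ a → IsIso (π.f j) := by
  have (j : ℤ) : ∃ (T : V) (m : T ⟶ Z.X j) (r : Z.X j ⟶ T), m ≫ r = 𝟙 T ∧
      (j ≤ a → r ≫ m = 𝟙 _) ∧ (a < j → IsZero T) := by
    by_cases h : j ≤ a
    · exact ⟨Z.X j, 𝟙 _, 𝟙 _, by simp, by simp, fun h' ↦ by lia⟩
    · exact ⟨0, 0, 0, (isZero_zero V).eq_of_src _ _, fun h' ↦ by lia, fun _ ↦ isZero_zero V⟩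
  choose T m r h₁ h₂ h₃ using this
  have key (i j : ℤ) : r i ≫ (m i ≫ Z.d i j ≫ r j) = Z.d i j ≫ r j := by
    by_cases hij : i + 1 = j
    · by_cases hi : a < j
      · exact (h₃ j hi).eq_of_tgt _ _
      · simp [reassoc_of% (h₂ i (by lia))]
    · simp [Z.shape i j hij]
  refine ⟨{ X := T, d := fun i j ↦ m i ≫ Z.d i j ≫ r j
            shape := fun i j h ↦ by simp [Z.shape i j h]
            d_comp_d' := fun i j k _ _ ↦ by simp [key j k] },
    { f := r, comm' := fun i j _ ↦ key i j }, fun j hj ↦ h₃ j hj,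
    fun j hj ↦ ⟨m j, h₂ j hj, h₁ j⟩⟩

/-- If the differential out of the lowest degree `p` is a section, then the contractible
subcomplex it generates is a direct summand. -/
lemma exists_idempotent {W : CochainComplex V ℤ} {p : ℤ} (hW : VanishBelow p W)
    (ρ : W.X (p + 1) ⟶ W.X p) (hρ : W.d p (p + 1) ≫ ρ = 𝟙 _) :
    ∃ ε : W ⟶ W, ε ≫ ε = ε ∧ ε.f p = 𝟙 _ ∧ ε.f (p + 1) = ρ ≫ W.d p (p + 1) ∧
      ∀ j, j ≠ p → j ≠ p + 1 → ε.f j = 0 := by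
  classical
  -- The commutation of `ε` with the differential in degree `p` is `d ≫ ρ ≫ d = d`; in degree `p +
  -- 1` both sides vanish because `d ≫ d = 0`.
  let f (j : ℤ) : W.X j ⟶ W.X j :=
    if j = p then 𝟙 _ else if h : j = p + 1 then (W.XIsoOfEq h).hom ≫ ρ ≫ W.d p j else 0
  have f₀ : f p = 𝟙 _ := if_pos rfl
  have f₁ : f (p + 1) = ρ ≫ W.d p (p + 1) := by simp [f]
  have f₂ (j : ℤ) (h : j ≠ p) (h' : j ≠ p + 1) : f j = 0 := by simp [f, h, h']
  have comm (i j : ℤ) (hij : i + 1 = j) : f i ≫ W.d i j = W.d i j ≫ f j := by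
    subst hij
    by_cases h0 : i < p
    · exact (hW i h0).eq_of_src _ _
    by_cases h1 : i = p
    · subst h1
      rw [f₀, f₁, reassoc_of% hρ, Category.id_comp]
    by_cases h2 : i = p + 1
    · subst h2
      rw [f₁, f₂ (p + 1 + 1) (by omega) (by omega)]
      simp
    · rw [f₂ i h1 h2, f₂ (i + 1) (by omega) (by omega), zero_comp, comp_zero]
  refine ⟨{ f := f, comm' := comm }, ?_, f₀, f₁, f₂⟩
  ext j
  change f j ≫ f j = f j
  by_cases h1 : j = p
  · subst h1
    rw [f₀, Category.id_comp]
  by_cases h2 : j = p + 1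
  · subst h2
    rw [f₁, Category.assoc, reassoc_of% hρ]
  · rw [f₂ j h1 h2, zero_comp]

/-- An object with local endomorphism ring whose differential out of the lowest degree `p` is a
section is concentrated in the degrees `p` and `p + 1`. -/
lemma IsFitting.contractible {X : CochainComplex V ℤ} (hX : IsFitting X) {p : ℤ}
    (hp : VanishBelow p X) (h0 : ¬ IsZero (X.X p)) (ρ : X.X (p + 1) ⟶ X.X p)
    (hρ : X.d p (p + 1) ≫ ρ = 𝟙 _) :
    VanishAbove (p + 1) X ∧ ρ ≫ X.d p (p + 1) = 𝟙 _ := by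
  obtain ⟨ε, hε, hε₀, hε₁, hε₂⟩ := exists_idempotent hp ρ hρ
  rcases hX.eq_zero_or_eq_id hε with rfl | rfl
  · exact (h0 ((IsZero.iff_id_eq_zero _).2 hε₀.symm)).elim
  · exact ⟨fun j hj ↦ (IsZero.iff_id_eq_zero _).2 (hε₂ j (by lia) (by lia)), hε₁.symm⟩

/-! ### Extensions of complexes described by a cocycle. -/

section Twist

variable [HasBinaryBiproducts V]

/-- The complex with cells `X^j ⊞ A^j` whose differential is twisted by `θ^j : A^j ⟶ X^(j+1)`. -/
noncomputable def twist (X A : CochainComplex V ℤ) (θ : ∀ i j, A.X i ⟶ X.X j)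
    (hs : ∀ i j, i + 1 ≠ j → θ i j = 0)
    (hθ : ∀ i j k, θ i j ≫ X.d j k + A.d i j ≫ θ j k = 0) : CochainComplex V ℤ where
  X j := X.X j ⊞ A.X j
  d i j := biprod.desc (X.d i j ≫ biprod.inl) (θ i j ≫ biprod.inl + A.d i j ≫ biprod.inr)
  shape i j h := by ext <;> simp [X.shape i j h, A.shape i j h, hs i j h]
  d_comp_d' i j k _ _ := by
    ext <;> simp
    simpa using hθ i j k

variable {X A : CochainComplex V ℤ} {θ : ∀ i j, A.X i ⟶ X.X j}
    {hs : ∀ i j, i + 1 ≠ j → θ i j = 0}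
    {hθ : ∀ i j k, θ i j ≫ X.d j k + A.d i j ≫ θ j k = 0}

variable (hs hθ) in
/-- The inclusion of the subcomplex of a twisted sum. -/
noncomputable def twistInl : X ⟶ twist X A θ hs hθ where
  f j := (biprod.inl : X.X j ⟶ X.X j ⊞ A.X j)
  comm' i j _ := by
    exact biprod.inl_desc (X.d i j ≫ biprod.inl) (θ i j ≫ biprod.inl + A.d i j ≫ biprod.inr)

variable (hs hθ) in
/-- The projection to the quotient complex of a twisted sum. -/
noncomputable def twistSnd : twist X A θ hs hθ ⟶ A where
  f j := (biprod.snd : X.X j ⊞ A.X j ⟶ A.X j)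
  comm' i j _ := by
    have h : (biprod.snd : X.X i ⊞ A.X i ⟶ _) ≫ A.d i j =
        biprod.desc (X.d i j ≫ biprod.inl) (θ i j ≫ biprod.inl + A.d i j ≫ biprod.inr) ≫
          biprod.snd := by ext <;> simp
    exact h

variable (hs hθ) in
/-- A morphism out of a twisted sum. -/
noncomputable def twistDesc {T : CochainComplex V ℤ} (a : X ⟶ T) (b : ∀ j, A.X j ⟶ T.X j)
    (hb : ∀ i j, i + 1 = j → b i ≫ T.d i j = θ i j ≫ a.f j + A.d i j ≫ b j) :
    twist X A θ hs hθ ⟶ T where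
  f j := (biprod.desc (a.f j) (b j) : X.X j ⊞ A.X j ⟶ T.X j)
  comm' i j h := by
    have h : biprod.desc (a.f i) (b i) ≫ T.d i j =
        biprod.desc (X.d i j ≫ biprod.inl) (θ i j ≫ biprod.inl + A.d i j ≫ biprod.inr) ≫
          biprod.desc (a.f j) (b j) := by
      ext
      · simp
      · simpa using hb i j h
    exact h

variable (X A θ hs hθ) in
lemma twist_d (i j : ℤ) : (twist X A θ hs hθ).d i j =
    (biprod.desc (X.d i j ≫ biprod.inl) (θ i j ≫ biprod.inl + A.d i j ≫ biprod.inr) :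
      X.X i ⊞ A.X i ⟶ X.X j ⊞ A.X j) := rfl

lemma twist_isZero_X {j : ℤ} (hX : IsZero (X.X j)) (hA : IsZero (A.X j)) :
    IsZero ((twist X A θ hs hθ).X j) := by
  change IsZero (X.X j ⊞ A.X j)
  rw [biprod_isZero_iff]
  exact ⟨hX, hA⟩

end Twist

end Complexes

/-! ### Decompositions of bounded complexes when the lengths are bounded -/

section Decompositions

open scoped ZeroObject

variable {V : Type u} [Category.{v} V] [Preadditive V]

lemma exists_lowest {Z : CochainComplex V ℤ} {p : ℤ} (hp : VanishBelow p Z) (h0 : ¬ IsZero Z) :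
    ∃ a, p ≤ a ∧ VanishBelow a Z ∧ ¬ IsZero (Z.X a) := by
  obtain ⟨a, ha, ha'⟩ := Int.exists_least_of_bdd (P := fun j ↦ ¬ IsZero (Z.X j))
    ⟨p, fun j hj ↦ not_lt.1 fun h ↦ hj (hp j h)⟩
    (by by_contra! h; exact h0 (isZero_complex_of_X h))
  exact ⟨a, not_lt.1 fun h ↦ ha (hp a h), fun j hj ↦ by_contra fun h ↦ absurd (ha' j h) (by lia), ha⟩

lemma exists_highest {Z : CochainComplex V ℤ} {q : ℤ} (hq : VanishAbove q Z) (h0 : ¬ IsZero Z) :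
    ∃ a, a ≤ q ∧ VanishAbove a Z ∧ ¬ IsZero (Z.X a) := by
  obtain ⟨a, ha, ha'⟩ := Int.exists_greatest_of_bdd (P := fun j ↦ ¬ IsZero (Z.X j))
    ⟨q, fun j hj ↦ not_lt.1 fun h ↦ hj (hq j h)⟩
    (by by_contra! h; exact h0 (isZero_complex_of_X h))
  exact ⟨a, not_lt.1 fun h ↦ ha (hq a h), fun j hj ↦ by_contra fun h ↦ absurd (ha' j h) (by lia), ha⟩

lemma finite_end (K : Type*) [Field K] [Linear K V] [∀ X Y : V, Module.Finite K (X ⟶ Y)]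
    {Z : CochainComplex V ℤ} {p q : ℤ} (hp : VanishBelow p Z) (hq : VanishAbove q Z) :
    Module.Finite K (End Z) := by
  let F : (Z ⟶ Z) →ₗ[K] (∀ j : Finset.Icc p q, (Z.X j ⟶ Z.X j)) :=
    { toFun := fun φ j ↦ φ.f j
      map_add' := fun _ _ ↦ rfl
      map_smul' := fun _ _ ↦ rfl }
  have hF : Function.Injective F := by
    intro φ ψ h
    ext j
    by_cases hj : j ∈ Finset.Icc p q
    · exact congrFun h ⟨j, hj⟩
    · rw [Finset.mem_Icc, not_and_or, not_le, not_le] at hj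
      exact (hj.elim (hp j) (hq j)).eq_of_src _ _
  exact Module.Finite.of_injective F hF

/-- `End A × End B` embeds block-diagonally into `End Z`, and both factors are nonzero. This makes
the dimension of `End Z` a measure for induction on direct sum decompositions. -/
lemma finrank_end_lt (K : Type*) [Field K] {C : Type*} [Category* C] [Preadditive C] [Linear K C]
    {Z A B : C} (D : Decomp Z A B) [Module.Finite K (End Z)] (hA : ¬ IsZero A) (hB : ¬ IsZero B) :
    Module.finrank K (End A) < Module.finrank K (End Z) ∧
      Module.finrank K (End B) < Module.finrank K (End Z) := by
  let F : ((A ⟶ A) × (B ⟶ B)) →ₗ[K] (Z ⟶ Z) :=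
    { toFun := fun φ ↦ D.p ≫ φ.1 ≫ D.i + D.q ≫ φ.2 ≫ D.j
      map_add' := fun φ ψ ↦ by simp; abel
      map_smul' := fun c φ ↦ by simp }
  have hF : Function.Injective F := by
    intro φ ψ h
    have h' : D.p ≫ φ.1 ≫ D.i + D.q ≫ φ.2 ≫ D.j = D.p ≫ ψ.1 ≫ D.i + D.q ≫ ψ.2 ≫ D.j := h
    ext
    · have := congrArg (fun t ↦ D.i ≫ t ≫ D.p) h'
      simpa [D.i_p, reassoc_of% D.i_p, reassoc_of% D.i_q] using this
    · have := congrArg (fun t ↦ D.j ≫ t ≫ D.q) h'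
      simpa [D.j_q, reassoc_of% D.j_q, reassoc_of% D.j_p] using this
  have hZ : Module.Finite K (Z ⟶ Z) := inferInstanceAs (Module.Finite K (End Z))
  have := Module.Finite.of_injective F hF
  have h₁ : Module.Finite K (A ⟶ A) :=
    Module.Finite.of_surjective (LinearMap.fst K (A ⟶ A) (B ⟶ B)) LinearMap.fst_surjective
  have h₂ : Module.Finite K (B ⟶ B) :=
    Module.Finite.of_surjective (LinearMap.snd K (A ⟶ A) (B ⟶ B)) LinearMap.snd_surjective
  have hle := LinearMap.finrank_le_finrank_of_injective hF
  rw [Module.finrank_prod] at hle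
  have : Nontrivial (A ⟶ A) := ⟨⟨𝟙 A, 0, fun h ↦ hA ((IsZero.iff_id_eq_zero _).2 h)⟩⟩
  have : Nontrivial (B ⟶ B) := ⟨⟨𝟙 B, 0, fun h ↦ hB ((IsZero.iff_id_eq_zero _).2 h)⟩⟩
  have e₁ := Module.finrank_pos (R := K) (M := A ⟶ A)
  have e₂ := Module.finrank_pos (R := K) (M := B ⟶ B)
  change Module.finrank K (A ⟶ A) < Module.finrank K (Z ⟶ Z) ∧
    Module.finrank K (B ⟶ B) < Module.finrank K (Z ⟶ Z)
  lia

variable [HasBinaryBiproducts V]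

/-- A bounded complex with local endomorphism ring which is not contractible is indecomposable
in `K^b(V)`. -/
lemma IsFitting.indecomposable_Kb {Z : CochainComplex V ℤ} (hZ : IsFitting Z)
    (hb : IsBounded V Z) (hc : ¬ Nonempty (Homotopy (𝟙 Z) 0)) :
    Indecomposable (C := Kb V)
      ⟨(HomotopyCategory.quotient V (ComplexShape.up ℤ)).obj Z, ⟨_, hb⟩⟩ := by
  refine IsFitting.indecomposable ?_ ?_
  · exact IsFitting.of_map (ObjectProperty.ι _)
      (hZ.map (HomotopyCategory.quotient V (ComplexShape.up ℤ)))
  · intro h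
    have h' := (ObjectProperty.ι _).map_isZero h
    rw [IsZero.iff_id_eq_zero] at h'
    refine hc ⟨HomotopyCategory.homotopyOfEq _ _ ?_⟩
    rw [CategoryTheory.Functor.map_zero, CategoryTheory.Functor.map_id]
    exact h'

/-- A nonzero contractible summand of `Z` would be all of `Z`, and the null-homotopy would transfer
to `𝟙 Z`. -/
lemma hasNoContractibleSummand_of_indecomposable {Z : CochainComplex V ℤ} (hZ : Indecomposable Z)
    (hc : ¬ Nonempty (Homotopy (𝟙 Z) 0)) : HasNoContractibleSummand Z := by
  rintro N N' ⟨e⟩ ⟨h⟩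
  refine (hZ.2 N N' e).resolve_right fun h' ↦ hc ⟨?_⟩
  let D := Decomp.ofIso e
  have h1 : D.p ≫ 𝟙 N ≫ D.i = 𝟙 Z := by
    rw [← D.total, h'.eq_of_tgt D.q 0]
    simp
  exact (Homotopy.ofEq h1.symm).trans (((h.compRight D.i).compLeft D.p).trans
    (Homotopy.ofEq (by simp)))

/-- If the lengths of the indecomposable objects of `K^b(V)` are at most `η`, then an
indecomposable bounded complex is supported in `η + 1` consecutive degrees. -/
lemma vanishAbove_of_indecomposable {η : ℕ} (hη : 1 ≤ η)
    (hlen : ∀ (X : Kb V) (l : ℕ), Indecomposable X → HasLength X l → l ≤ η)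
    {Z : CochainComplex V ℤ} (hZ : Indecomposable Z) (hF : IsFitting Z) {a q : ℤ}
    (ha : VanishBelow a Z) (h0 : ¬ IsZero (Z.X a)) (hq : VanishAbove q Z) :
    VanishAbove (a + η) Z := by
  by_cases hc : Nonempty (Homotopy (𝟙 Z) 0)
  -- In the lowest degree the null-homotopy is a retraction of the differential, so `Z` lives in
  -- degrees `a` and `a + 1`, inside the window because `η ≥ 1`.
  · obtain ⟨h⟩ := hc
    refine (hF.contractible ha h0 (h.hom (a + 1) a) ?_).1.mono (by lia)
    have := h.comm a
    rw [dNext_eq h.hom (show (ComplexShape.up ℤ).Rel a (a + 1) from rfl),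
      prevD_eq h.hom (show (ComplexShape.up ℤ).Rel (a - 1) a from by simp),
      (ha (a - 1) (by lia)).eq_of_tgt (h.hom a (a - 1)) 0] at this
    simpa using this.symm
  · obtain ⟨s, hs, hs', hs0⟩ := exists_highest hq hZ.1
    have has : a ≤ s := not_lt.1 fun h ↦ hs0 (ha s h)
    obtain ⟨l, hl⟩ := Int.le.dest has
    -- Here `Z` is its own representative without contractible summands, so `s - a` is the length of
    -- an indecomposable object of `K^b(V)`.
    have := hlen _ l (hF.indecomposable_Kb ⟨a, q, fun j hj ↦ hj.elim (ha j) (hq j)⟩ hc)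
      ⟨Z, a, s, ⟨Iso.refl _⟩, hasNoContractibleSummand_of_indecomposable hZ hc, h0, hs0,
        fun j hj ↦ hj.elim (ha j) (hs' j), by lia⟩
    exact hs'.mono (by lia)

variable (V) in
/-- The bounded indecomposable complexes have local endomorphism rings, and the part of a bounded
complex that meets its lowest degree can be split off in `η + 1` consecutive degrees. -/
structure IsLengthBounded (η : ℕ) : Prop where
  fitting (Z : CochainComplex V ℤ) (p q : ℤ) (hp : VanishBelow p Z) (hq : VanishAbove q Z)
    (hZ : Indecomposable Z) : IsFitting Z
  decomp (Z : CochainComplex V ℤ) (p q : ℤ) (hp : VanishBelow p Z) (hq : VanishAbove q Z) :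
    ∃ A B, Nonempty (Decomp Z A B) ∧ VanishAbove (p + η) A ∧ VanishBelow (p + 1) B

/-- Induction on the dimension of `End Z`. An indecomposable `Z` goes wholly to `A` if `Z^p ≠ 0`
(the window principle bounds it above) and wholly to `B` if `Z^p = 0`; otherwise the decompositions
of two proper summands are added. -/
lemma isLengthBounded [HasZeroObject V] [IsIdempotentComplete V] (K : Type*) [Field K]
    [Linear K V] [∀ X Y : V, Module.Finite K (X ⟶ Y)] {η : ℕ} (hη : 1 ≤ η)
    (hlen : ∀ (X : Kb V) (l : ℕ), Indecomposable X → HasLength X l → l ≤ η) :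
    IsLengthBounded V η := by
  have fit (Z : CochainComplex V ℤ) (p q : ℤ) (hp : VanishBelow p Z) (hq : VanishAbove q Z)
      (hZ : Indecomposable Z) : IsFitting Z := by
    have := finite_end K hp hq
    exact isFitting_of_indecomposable K hZ
  refine ⟨fit, fun Z p q hp hq ↦ ?_⟩
  obtain ⟨n, hn⟩ : ∃ n, Module.finrank K (End Z) = n := ⟨_, rfl⟩
  induction n using Nat.strong_induction_on generalizing Z with
  | _ n ih =>
    have hO : IsZero (0 : CochainComplex V ℤ) := isZero_zero _
    by_cases h0 : IsZero Z
    · exact ⟨Z, Z, ⟨Decomp.left Z h0⟩, fun j _ ↦ Functor.map_isZero (HomologicalComplex.eval _ _ j) h0,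
        fun j _ ↦ Functor.map_isZero (HomologicalComplex.eval _ _ j) h0⟩
    by_cases hZ : Indecomposable Z
    · have hF := fit Z p q hp hq hZ
      by_cases hpz : IsZero (Z.X p)
      · refine ⟨0, Z, ⟨Decomp.right Z hO⟩,
          fun j _ ↦ Functor.map_isZero (HomologicalComplex.eval _ _ j) hO, fun j hj ↦ ?_⟩
        rcases (show j < p ∨ j = p by lia) with h | rfl
        · exact hp j h
        · exact hpz
      · exact ⟨Z, 0, ⟨Decomp.left Z hO⟩, vanishAbove_of_indecomposable hη hlen hZ hF hp hpz hq,
          fun j _ ↦ Functor.map_isZero (HomologicalComplex.eval _ _ j) hO⟩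
    · simp only [Indecomposable, not_and, not_forall, not_or] at hZ
      obtain ⟨Y, W, e, hY, hW⟩ := hZ h0
      let D := Decomp.ofIso e
      have := finite_end K hp hq
      obtain ⟨h₁, h₂⟩ := finrank_end_lt K D hY hW
      obtain ⟨A₁, B₁, ⟨D₁⟩, hA₁, hB₁⟩ := ih _ (hn ▸ h₁) Y (hp.of_retract D.i_p)
        (hq.of_retract D.i_p) rfl
      obtain ⟨A₂, B₂, ⟨D₂⟩, hA₂, hB₂⟩ := ih _ (hn ▸ h₂) W (hp.of_retract D.j_q)
        (hq.of_retract D.j_q) rfl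
      exact ⟨_, _, ⟨D.trans D₁ D₂⟩, fun j hj ↦ biprod_isZero_X (hA₁ j hj) (hA₂ j hj),
        fun j hj ↦ biprod_isZero_X (hB₁ j hj) (hB₂ j hj)⟩

/-- The projection of `Z` onto `A` is an idempotent, hence `0` or `1`; it is not `0`, since `Z`
would then be a retract of `B`, which vanishes in degree `a`. -/
lemma IsLengthBounded.vanishAbove {η : ℕ} (H : IsLengthBounded V η) {Z : CochainComplex V ℤ}
    (hZ : IsFitting Z) {a q : ℤ} (ha : VanishBelow a Z) (h0 : ¬ IsZero (Z.X a))
    (hq : VanishAbove q Z) : VanishAbove (a + η) Z := by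
  obtain ⟨A, B, ⟨D⟩, hA, hB⟩ := H.decomp Z a q ha hq
  have hpa : D.p ≫ D.i = 𝟙 Z := by
    refine (hZ.eq_zero_or_eq_id (e := D.p ≫ D.i) (by rw [Category.assoc, reassoc_of% D.i_p])).resolve_left
      fun h ↦ h0 (isZero_X_of_retract (i := D.q) (p := D.j) ?_ (hB a (by lia)))
    rw [← D.total, h, zero_add]
  exact hA.of_retract hpa

end Decompositions

/-! ### Factorization of the morphisms that vanish in the lowest degree -/

section Factorization

open scoped ZeroObject

variable {V : Type u} [Category.{v} V] [Preadditive V]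

/-- The family of morphisms `A^i ⟶ Y^j` given by a map of degree one. -/
noncomputable def degOne {A : ℤ → V} {Y : CochainComplex V ℤ} (t : ∀ i, A i ⟶ Y.X (i + 1))
    (i j : ℤ) : A i ⟶ Y.X j :=
  if h : i + 1 = j then t i ≫ (Y.XIsoOfEq h).hom else 0

lemma degOne_self {A : ℤ → V} {Y : CochainComplex V ℤ} (t : ∀ i, A i ⟶ Y.X (i + 1)) (i : ℤ) :
    degOne t i (i + 1) = t i := by simp [degOne]

lemma degOne_of_ne {A : ℤ → V} {Y : CochainComplex V ℤ} (t : ∀ i, A i ⟶ Y.X (i + 1)) (i j : ℤ)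
    (h : i + 1 ≠ j) : degOne t i j = 0 := by simp [degOne, h]

lemma degOne_comp {A Y : CochainComplex V ℤ} (t : ∀ i, A.X i ⟶ Y.X (i + 1))
    (ht : ∀ i, t i ≫ Y.d (i + 1) (i + 1 + 1) + A.d i (i + 1) ≫ t (i + 1) = 0) (i j k : ℤ) :
    degOne t i j ≫ Y.d j k + A.d i j ≫ degOne t j k = 0 := by
  by_cases hij : i + 1 = j
  · subst hij
    by_cases hjk : i + 1 + 1 = k
    · subst hjk
      rw [degOne_self, degOne_self, ht]
    · rw [degOne_of_ne _ _ _ hjk, Y.shape _ _ hjk]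
      simp
  · rw [degOne_of_ne _ _ _ hij, A.shape _ _ hij]
    simp

/-- The shifted complex, with the differentials of the opposite sign. -/
def shiftOne (X : CochainComplex V ℤ) : CochainComplex V ℤ where
  X i := X.X (i + 1)
  d i j := -X.d (i + 1) (j + 1)
  shape i j h := by
    rw [X.shape _ _ (fun h' ↦ h (by simp only [ComplexShape.up_Rel] at h' ⊢; lia)), neg_zero]
  d_comp_d' i j k _ _ := by simp

/-- The mapping cone of `u : X ⟶ M`. -/
noncomputable abbrev coneOf [HasBinaryBiproducts V] {X M : CochainComplex V ℤ} (u : X ⟶ M) :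
    CochainComplex V ℤ :=
  twist M (shiftOne X) (degOne (fun i ↦ u.f (i + 1))) (degOne_of_ne _)
    (degOne_comp (A := shiftOne X) _ fun i ↦ by
      have h : u.f (i + 1) ≫ M.d (i + 1) (i + 1 + 1) +
          (-X.d (i + 1) (i + 1 + 1)) ≫ u.f (i + 1 + 1) = 0 := by simp
      exact h)

variable [HasBinaryBiproducts V]

lemma twist_degOne_d {X A : CochainComplex V ℤ} (t : ∀ i, A.X i ⟶ X.X (i + 1)) (hs hθ) (i : ℤ) :
    (twist X A (degOne t) hs hθ).d i (i + 1) = (biprod.desc (X.d i (i + 1) ≫ biprod.inl)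
      (t i ≫ biprod.inl + A.d i (i + 1) ≫ biprod.inr) :
        X.X i ⊞ A.X i ⟶ X.X (i + 1) ⊞ A.X (i + 1)) := by
  rw [twist_d, degOne_self]

lemma coneOf_d {X M : CochainComplex V ℤ} (u : X ⟶ M) (i : ℤ) :
    (coneOf u).d i (i + 1) = (biprod.desc (M.d i (i + 1) ≫ biprod.inl)
      (u.f (i + 1) ≫ biprod.inl - X.d (i + 1) (i + 1 + 1) ≫ biprod.inr) :
        M.X i ⊞ X.X (i + 1) ⟶ M.X (i + 1) ⊞ X.X (i + 1 + 1)) := by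
  refine (twist_degOne_d (A := shiftOne X) _ _ _ i).trans ?_
  rw [sub_eq_add_neg, ← Preadditive.neg_comp]
  rfl

/-- A morphism from `X` that vanishes in the lowest degree `b + 1` of `X` factors through a
morphism that is not a section and ends in a complex supported in `η + 1` degrees from `b + 1`. -/
lemma IsLengthBounded.exists_factorization [HasZeroObject V] [IsIdempotentComplete V] {η : ℕ}
    (H : IsLengthBounded V η) {X M : CochainComplex V ℤ} (hX : IsFitting X) {b q : ℤ}
    (hXb : VanishBelow (b + 1) X) (h0 : ¬ IsZero (X.X (b + 1))) (hXq : VanishAbove q X)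
    (hMb : VanishBelow (b + 2) M) (hMq : VanishAbove q M) (u : X ⟶ M) :
    ∃ (U : CochainComplex V ℤ) (s : X ⟶ U) (t : U ⟶ M), s ≫ t = u ∧ ¬ IsSplitMono s ∧
      VanishBelow (b + 1) U ∧ VanishAbove q U ∧ VanishAbove (b + 1 + η) U := by
  -- If the lowest differential of `X` is a section, `X` is contractible in two degrees and `u = 0`,
  -- since `u` vanishes in the lower one; then `U = 0` serves.
  by_cases hρ : ∃ ρ : X.X (b + 1 + 1) ⟶ X.X (b + 1), X.d (b + 1) (b + 1 + 1) ≫ ρ = 𝟙 _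
  · obtain ⟨ρ, hρ⟩ := hρ
    obtain ⟨hX', hρ'⟩ := hX.contractible hXb h0 ρ hρ
    have hO (j : ℤ) : IsZero ((0 : CochainComplex V ℤ).X j) :=
      Functor.map_isZero (HomologicalComplex.eval _ _ j) (isZero_zero _)
    refine ⟨0, 0, 0, ?_, fun h ↦ h0 ?_, fun j _ ↦ hO j, fun j _ ↦ hO j, fun j _ ↦ hO j⟩
    · ext j
      rw [comp_zero]
      by_cases h1 : j < b + 2
      · exact (hMb j h1).eq_of_tgt _ _
      by_cases h2 : b + 1 + 1 < j
      · exact (hX' j h2).eq_of_src _ _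
      obtain rfl : j = b + 1 + 1 := by lia
      rw [← Category.id_comp (u.f _), ← hρ', Category.assoc, ← u.comm,
        (hMb (b + 1) (by lia)).eq_of_tgt (u.f (b + 1)) 0]
      simp
    · exact isZero_X_of_retract h.exists_splitMono.some.id (hO _)
  have hCb : VanishBelow b (coneOf u) := fun j hj ↦
    twist_isZero_X (hMb j (by lia)) (hXb (j + 1) (by lia))
  have hCq : VanishAbove q (coneOf u) := fun j hj ↦
    twist_isZero_X (hMq j (by lia)) (hXq (j + 1) (by lia))
  -- The cone starts in degree `b`, where it is `X^(b+1)` because `M^b = 0`. Its summand `A` carries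
  -- this cell and ends at `b + η`.
  obtain ⟨A, B, ⟨D⟩, hA, hB⟩ := H.decomp (coneOf u) b q hCb hCq
  let i (j : ℤ) : A.X j ⟶ M.X j ⊞ X.X (j + 1) := D.i.f j
  let p (j : ℤ) : M.X j ⊞ X.X (j + 1) ⟶ A.X j := D.p.f j
  have hi (j : ℤ) : i j ≫ biprod.desc (M.d j (j + 1) ≫ biprod.inl)
      (u.f (j + 1) ≫ biprod.inl - X.d (j + 1) (j + 1 + 1) ≫ biprod.inr) =
        A.d j (j + 1) ≫ i (j + 1) := by
    have := D.i.comm j (j + 1)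
    rwa [coneOf_d] at this
  have hp (j : ℤ) : biprod.desc (M.d j (j + 1) ≫ biprod.inl)
      (u.f (j + 1) ≫ biprod.inl - X.d (j + 1) (j + 1 + 1) ≫ biprod.inr) ≫ p (j + 1) =
        p j ≫ A.d j (j + 1) := by
    have := D.p.comm j (j + 1)
    rw [coneOf_d] at this
    exact this.symm
  have hip (j : ℤ) : i j ≫ p j = 𝟙 _ := by
    have := congrArg (fun t ↦ HomologicalComplex.Hom.f t j) D.i_p
    exact this
  have hpi : p b ≫ i b = 𝟙 _ := by
    have := congrArg (fun t ↦ HomologicalComplex.Hom.f t b) D.total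
    simp only [HomologicalComplex.add_f_apply, HomologicalComplex.comp_f,
      HomologicalComplex.id_f, (hB b (by lia)).eq_of_tgt (D.q.f b) 0, zero_comp, add_zero] at this
    exact this
  -- The two components of the chain map `A ⟶ coneOf u`: the one into the shift of `X` is a cocycle
  -- (`hsnd`), and the one into `M` is a null-homotopy of its composite with `u` (`hfst`).
  have hfst (j : ℤ) : (i j ≫ biprod.fst) ≫ M.d j (j + 1) + (i j ≫ biprod.snd) ≫ u.f (j + 1) =
      A.d j (j + 1) ≫ i (j + 1) ≫ biprod.fst := by
    rw [← reassoc_of% hi j]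
    have : biprod.desc (M.d j (j + 1) ≫ biprod.inl)
      (u.f (j + 1) ≫ biprod.inl - X.d (j + 1) (j + 1 + 1) ≫ biprod.inr) ≫ biprod.fst =
        biprod.fst ≫ M.d j (j + 1) + biprod.snd ≫ u.f (j + 1) := by
      ext <;> simp
    rw [this]
    simp
  have hsnd (j : ℤ) : (i j ≫ biprod.snd) ≫ X.d (j + 1) (j + 1 + 1) +
      A.d j (j + 1) ≫ i (j + 1) ≫ biprod.snd = 0 := by
    rw [← reassoc_of% hi j]
    have : biprod.desc (M.d j (j + 1) ≫ biprod.inl)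
      (u.f (j + 1) ≫ biprod.inl - X.d (j + 1) (j + 1 + 1) ≫ biprod.inr) ≫ biprod.snd =
        - biprod.snd ≫ X.d (j + 1) (j + 1 + 1) := by
      ext <;> simp
    rw [this]
    simp
  have hMb0 : IsZero (M.X b) := hMb b (by lia)
  have hMb1 : IsZero (M.X (b + 1)) := hMb (b + 1) (by lia)
  have hXb0 : IsZero (X.X b) := hXb b (by lia)
  -- `π` is the cocycle of an extension of `A` by `X`; in degree `b` it is an isomorphism with
  -- inverse `k`.
  let π (j : ℤ) : A.X j ⟶ X.X (j + 1) := i j ≫ biprod.snd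
  let k : X.X (b + 1) ⟶ A.X b := biprod.inr ≫ p b
  have hπk : π b ≫ k = 𝟙 _ := by
    have h := biprod.total (X := M.X b) (Y := X.X (b + 1))
    rw [hMb0.eq_of_tgt biprod.fst 0, zero_comp, zero_add] at h
    simp only [π, k, Category.assoc, reassoc_of% h, hip]
  have hkπ : k ≫ π b = 𝟙 _ := by
    simp only [π, k, Category.assoc, reassoc_of% hpi, biprod.inr_snd]
  have hsW := degOne_of_ne π
  have hθW := degOne_comp π hsnd
  let W := twist X A (degOne π) hsW hθW
  have hWd : W.d b (b + 1) = (biprod.desc (X.d b (b + 1) ≫ biprod.inl)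
      (π b ≫ biprod.inl + A.d b (b + 1) ≫ biprod.inr) :
        X.X b ⊞ A.X b ⟶ X.X (b + 1) ⊞ A.X (b + 1)) := twist_degOne_d π hsW hθW b
  have hWb : VanishBelow b W := fun j hj ↦ twist_isZero_X (hXb j (by lia))
    (hCb.of_retract D.i_p j hj)
  have hWq : VanishAbove q W := fun j hj ↦ twist_isZero_X (hXq j hj) (hCq.of_retract D.i_p j hj)
  have hWη : VanishAbove (b + 1 + η) W := fun j hj ↦ twist_isZero_X
    (H.vanishAbove hX hXb h0 hXq j (by lia)) (hA j (by lia))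
  -- The null-homotopy `hfst` is exactly what is needed to extend `u` from `X` to the extension `W`.
  let t : W ⟶ M := twistDesc hsW hθW u (fun j ↦ -(i j ≫ biprod.fst)) (by
    rintro j _ rfl
    rw [degOne_self, Preadditive.neg_comp, Preadditive.comp_neg, ← hfst]
    simp only [π]
    abel)
  have ht : twistInl hsW hθW ≫ t = u := by
    ext j
    exact biprod.inl_desc _ _
  -- `W` still has the unwanted cell `A^b` in degree `b`. As `π b` is invertible, the differential
  -- out of it is a section, so a contractible summand in degrees `b`, `b + 1` splits off; `t` kills
  -- it since `M` vanishes there. The complement is `U`.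
  obtain ⟨ε, hε, hε₀, -, hε₂⟩ := exists_idempotent hWb
    (biprod.desc (k ≫ biprod.inr) 0 : X.X (b + 1) ⊞ A.X (b + 1) ⟶ X.X b ⊞ A.X b) (by
      rw [hWd]
      have : biprod.desc (X.d b (b + 1) ≫ biprod.inl)
        (π b ≫ biprod.inl + A.d b (b + 1) ≫ biprod.inr) ≫ biprod.desc (k ≫ biprod.inr) 0 =
          𝟙 (X.X b ⊞ A.X b) := by
        ext1
        · exact hXb0.eq_of_src _ _
        · simp [reassoc_of% hπk]
      exact this)
  have hεt : ε ≫ t = 0 := by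
    ext j
    rw [HomologicalComplex.comp_f, HomologicalComplex.zero_f]
    by_cases h1 : j = b
    · subst h1
      exact hMb0.eq_of_tgt _ _
    by_cases h2 : j = b + 1
    · subst h2
      exact hMb1.eq_of_tgt _ _
    · rw [hε₂ j h1 h2, zero_comp]
  obtain ⟨U, iU, pU, hU, hU'⟩ := IsIdempotentComplete.idempotents_split W (𝟙 W - ε)
    (Idempotents.idem_of_id_sub_idem _ hε)
  refine ⟨U, twistInl hsW hθW ≫ pU, iU ≫ t, ?_, fun hs ↦ hρ ?_, fun j hj ↦ ?_,
    hWq.of_retract hU, hWη.of_retract hU⟩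
  · rw [Category.assoc, reassoc_of% hU', Preadditive.sub_comp, hεt, Category.id_comp, sub_zero, ht]
  -- A retraction of `s` extends `𝟙 X` to `W ⟶ X`. Its component on `A` trivializes `π`, and
  -- combined with the projection of the cone to `A` it yields a retraction of the lowest
  -- differential of `X`, which was excluded.
  · obtain ⟨⟨r, hr⟩⟩ := hs
    have hR (j : ℤ) : (biprod.inl : _ ⟶ X.X j ⊞ A.X j) ≫ (pU ≫ r).f j = 𝟙 _ := by
      rw [Category.assoc] at hr
      exact congrArg (fun t ↦ HomologicalComplex.Hom.f t j) hr
    let R (j : ℤ) : X.X j ⊞ A.X j ⟶ X.X j := (pU ≫ r).f j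
    have hRc : biprod.desc (X.d b (b + 1) ≫ biprod.inl)
        (π b ≫ biprod.inl + A.d b (b + 1) ≫ biprod.inr) ≫ R (b + 1) = 0 := by
      have := (pU ≫ r).comm b (b + 1)
      rw [hWd, hXb0.eq_of_tgt ((pU ≫ r).f b) 0, zero_comp] at this
      exact this.symm
    have hRc' : π b + A.d b (b + 1) ≫ biprod.inr ≫ R (b + 1) = 0 := by
      have h := congrArg (fun t ↦ biprod.inr ≫ t) hRc
      have hR' : biprod.inl ≫ R (b + 1) = 𝟙 _ := hR (b + 1)
      simpa [hR'] using h
    have hd : X.d (b + 1) (b + 1 + 1) ≫ biprod.inr ≫ p (b + 1) = - k ≫ A.d b (b + 1) := by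
      have h := congrArg (fun t ↦ biprod.inr ≫ t) (hp b)
      simp only [biprod.inr_desc_assoc,
        hMb1.eq_of_tgt (u.f (b + 1)) 0, zero_comp, zero_sub] at h
      rw [Preadditive.neg_comp, Category.assoc] at h
      rw [← neg_eq_iff_eq_neg, h]
      simp [k]
    refine ⟨biprod.inr ≫ p (b + 1) ≫ biprod.inr ≫ R (b + 1), ?_⟩
    have h1 : A.d b (b + 1) ≫ biprod.inr ≫ R (b + 1) = - π b := by
      rw [eq_neg_iff_add_eq_zero]
      exact (add_comm _ _).trans hRc'
    rw [reassoc_of% hd, Preadditive.neg_comp, Category.assoc, h1, Preadditive.comp_neg, neg_neg, hkπ]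
  · rcases (show j < b ∨ j = b by lia) with h | rfl
    · exact hWb.of_retract hU j h
    · rw [IsZero.iff_id_eq_zero]
      have h1 : pU ≫ iU ≫ pU = pU := by rw [hU, Category.comp_id]
      rw [reassoc_of% hU'] at h1
      have h2 := congrArg (fun t ↦ HomologicalComplex.Hom.f t j) h1
      simp only [HomologicalComplex.comp_f, HomologicalComplex.sub_f_apply,
        HomologicalComplex.id_f, hε₀, sub_self, zero_comp] at h2
      have h3 := congrArg (fun t ↦ HomologicalComplex.Hom.f t j) hU
      simp only [HomologicalComplex.comp_f, ← h2, comp_zero, HomologicalComplex.id_f] at h3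
      exact h3.symm

end Factorization

/-! ### The inclusions and truncations -/

section Functors

variable {V : Type u} [Category.{v} V] [Preadditive V]

instance (a : ℤ) : (translate V a).Faithful where
  map_injective {X Y f g} h := by
    ext j
    obtain ⟨i, rfl⟩ : ∃ i, j = i + a := ⟨j - a, by lia⟩
    exact congrArg (fun t ↦ HomologicalComplex.Hom.f t i) h

instance (a : ℤ) : (translate V a).Full where
  map_surjective {X Y} g := by
    have h (j : ℤ) : j - a + a = j := by lia
    obtain ⟨g', hg', hc⟩ : ∃ g' : ∀ j, X.X (j + a) ⟶ Y.X (j + a), (∀ j, g' j = g.f j) ∧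
        ∀ i j, i + 1 = j → g' i ≫ Y.d (i + a) (j + a) = X.d (i + a) (j + a) ≫ g' j :=
      ⟨g.f, fun _ ↦ rfl, fun i j h ↦ g.comm' i j h⟩
    refine ⟨{ f := fun j ↦ (X.XIsoOfEq (h j)).inv ≫ g' (j - a) ≫ (Y.XIsoOfEq (h j)).hom
              comm' := fun i j hij ↦ ?_ }, ?_⟩
    · have := hc (i - a) (j - a) (by simp only [ComplexShape.up_Rel] at hij; lia)
      simp only [Category.assoc, HomologicalComplex.XIsoOfEq_hom_comp_d]
      rw [← cancel_epi (X.XIsoOfEq (h i)).hom, ← cancel_mono (Y.XIsoOfEq (h j)).inv]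
      simpa using this
    · ext i
      rw [← hg']
      have key (k : ℤ) (hk : k = i) (hk' : k + a = i + a) :
          (X.XIsoOfEq hk').inv ≫ g' k ≫ (Y.XIsoOfEq hk').hom = g' i := by
        subst hk
        simp
      exact key _ (by lia) _

instance (n : ℕ) : (leftIncl V n).Faithful where
  map_injective {X Y f g} h := by
    ext1
    exact (translate V (-1)).map_injective (congrArg (fun t ↦ t.hom) h)

instance (n : ℕ) : (leftIncl V n).Full where
  map_surjective {X Y} g := by
    obtain ⟨f, hf⟩ := (translate V (-1)).map_surjective g.hom
    exact ⟨ObjectProperty.homMk f, by ext1; exact hf⟩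

instance (n : ℕ) : (rightIncl V n).Faithful where
  map_injective {X Y f g} h := by
    ext1
    exact congrArg (fun t ↦ t.hom) h

instance (n : ℕ) : (rightIncl V n).Full where
  map_surjective {X Y} g := ⟨ObjectProperty.homMk g.hom, by ext1; rfl⟩

instance (n : ℕ) (s : Side) : (incl V n s).Faithful := by
  cases s
  · exact inferInstanceAs (leftIncl V n).Faithful
  · exact inferInstanceAs (rightIncl V n).Faithful

instance (n : ℕ) (s : Side) : (incl V n s).Full := by
  cases s
  · exact inferInstanceAs (leftIncl V n).Full
  · exact inferInstanceAs (rightIncl V n).Full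

/-- Translations by opposite integers are inverse to each other. -/
def translateTranslateIso (a b : ℤ) (h : a + b = 0) : translate V a ⋙ translate V b ≅ 𝟭 _ :=
  NatIso.ofComponents
    (fun X ↦ HomologicalComplex.Hom.isoOfComponents
      (fun i ↦ X.XIsoOfEq (show i + b + a = i by lia)) (fun i j _ ↦
        (X.XIsoOfEq_hom_comp_d _ _).trans (X.d_comp_XIsoOfEq_hom _ _).symm))
    (fun f ↦ by
      ext i
      exact HomologicalComplex.XIsoOfEq_hom_naturality f (show i + b + a = i by lia))

section Truncation

variable [HasZeroObject V]

lemma stupidTruncXIso_hom_comp_d {ι ι' : Type*} {c : ComplexShape ι} {c' : ComplexShape ι'}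
    (X : HomologicalComplex V c') (e : c.Embedding c') [e.IsRelIff] {i j : ι} {i' j' : ι'}
    (hi : e.f i = i') (hj : e.f j = j') :
    (X.stupidTruncXIso e hi).hom ≫ X.d i' j' =
      (X.stupidTrunc e).d i' j' ≫ (X.stupidTruncXIso e hj).hom := by
  subst hi hj
  let α (k : ι) : (X.stupidTrunc e).X (e.f k) ≅ X.X (e.f k) := (X.restriction e).extendXIso e rfl
  have hα (k : ι) : (X.stupidTruncXIso e (rfl : e.f k = e.f k)).hom = (α k).hom :=
    Category.comp_id _
  have h : (X.stupidTrunc e).d (e.f i) (e.f j) = (α i).hom ≫ X.d (e.f i) (e.f j) ≫ (α j).inv :=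
    (X.restriction e).extend_d_eq e rfl rfl
  rw [h, hα, hα]
  simp

open scoped Classical in
/-- The comparison of the brutal truncation of a complex with the complex. -/
noncomputable def stupidTruncXHom {ι ι' : Type*} {c : ComplexShape ι} {c' : ComplexShape ι'}
    (X : HomologicalComplex V c') (e : c.Embedding c') [e.IsRelIff] (j : ι') :
    (X.stupidTrunc e).X j ⟶ X.X j :=
  if h : ∃ i, e.f i = j then (X.stupidTruncXIso e h.choose_spec).hom else 0

/-- A complex supported in the image of an embedding is isomorphic to its brutal truncation. -/
noncomputable def stupidTruncIso {ι ι' : Type*} {c : ComplexShape ι} {c' : ComplexShape ι'}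
    (X : HomologicalComplex V c') (e : c.Embedding c') [e.IsRelIff]
    (hX : ∀ j, (∀ i, e.f i ≠ j) → IsZero (X.X j)) : X.stupidTrunc e ≅ X :=
  have h (j : ι') : IsIso (stupidTruncXHom X e j) := by
    by_cases h : ∃ i, e.f i = j
    · simp only [stupidTruncXHom, dif_pos h]
      infer_instance
    · push Not at h
      exact ⟨0, (HomologicalComplex.isZero_stupidTrunc_X _ _ _ h).eq_of_src _ _,
        (hX j h).eq_of_src _ _⟩
  HomologicalComplex.Hom.isoOfComponents (fun j ↦ asIso (stupidTruncXHom X e j)) (fun i j _ ↦ by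
    by_cases hi : ∃ k, e.f k = i
    · by_cases hj : ∃ k, e.f k = j
      · simpa only [asIso_hom, stupidTruncXHom, dif_pos hi, dif_pos hj] using
          stupidTruncXIso_hom_comp_d X e hi.choose_spec hj.choose_spec
      · push Not at hj
        exact (hX j hj).eq_of_tgt _ _
    · push Not at hi
      exact (HomologicalComplex.isZero_stupidTrunc_X _ _ _ hi).eq_of_src _ _)

lemma stupidTruncIso_naturality {ι ι' : Type*} {c : ComplexShape ι} {c' : ComplexShape ι'}
    {X Y : HomologicalComplex V c'} (f : X ⟶ Y) (e : c.Embedding c') [e.IsRelIff]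
    (hX : ∀ j, (∀ i, e.f i ≠ j) → IsZero (X.X j)) (hY : ∀ j, (∀ i, e.f i ≠ j) → IsZero (Y.X j)) :
    HomologicalComplex.stupidTruncMap f e ≫ (stupidTruncIso Y e hY).hom =
      (stupidTruncIso X e hX).hom ≫ f := by
  ext j
  by_cases hj : ∃ k, e.f k = j
  · have := HomologicalComplex.stupidTruncMap_stupidTruncXIso_hom f e hj.choose_spec
    simp only [HomologicalComplex.comp_f, stupidTruncIso,
      HomologicalComplex.Hom.isoOfComponents_hom_f, asIso_hom, stupidTruncXHom, dif_pos hj]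
    exact this
  · push Not at hj
    exact (hY j hj).eq_of_tgt _ _

lemma rightIncl_rightTrunc (n : ℕ) : Nonempty (rightIncl V n ⋙ rightTrunc V n ≅ 𝟭 _) := by
  have h (X : FixedSize V n) (j : ℤ)
      (hj : ∀ i, (ComplexShape.embeddingUpIntLE (n : ℤ)).f i ≠ j) : IsZero (X.obj.X j) :=
    X.property j (by
      by_contra h
      obtain ⟨i, hi⟩ := Int.le.dest (show j ≤ (n : ℤ) by lia)
      exact hj i (by simp only [ComplexShape.embeddingUpIntLE_f]; lia))
  exact ⟨NatIso.ofComponents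
    (fun X ↦ ObjectProperty.isoMk _ (stupidTruncIso X.obj _ (h X)))
    (fun {X Y} f ↦ by
      ext1
      exact stupidTruncIso_naturality f.hom _ (h X) (h Y))⟩

lemma leftIncl_leftTrunc (n : ℕ) : Nonempty (leftIncl V n ⋙ leftTrunc V n ≅ 𝟭 _) := by
  let τ := translateTranslateIso (V := V) (-1) 1 rfl
  have h (X : FixedSize V n) (j : ℤ)
      (hj : ∀ i, (ComplexShape.embeddingUpIntGE (1 : ℤ)).f i ≠ j) :
      IsZero (((translate V (-1) ⋙ translate V 1).obj X.obj).X j) :=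
    X.property _ (by
      by_contra h
      obtain ⟨i, hi⟩ := Int.le.dest (show 1 ≤ j by lia)
      exact hj i (by simp only [ComplexShape.embeddingUpIntGE_f]; lia))
  exact ⟨NatIso.ofComponents
    (fun X ↦ ObjectProperty.isoMk _ (stupidTruncIso _ _ (h X) ≪≫ τ.app X.obj))
    (fun {X Y} f ↦ by
      ext1
      have h₁ := stupidTruncIso_naturality ((translate V (-1) ⋙ translate V 1).map f.hom)
        (ComplexShape.embeddingUpIntGE (1 : ℤ)) (h X) (h Y)
      have h₂ := τ.hom.naturality f.hom
      exact ((reassoc_of% h₁) _).trans ((congrArg _ h₂).trans (Category.assoc _ _ _).symm))⟩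

lemma incl_trunc (n : ℕ) (s : Side) : Nonempty (incl V n s ⋙ trunc V n s ≅ 𝟭 _) := by
  cases s
  · exact leftIncl_leftTrunc n
  · exact rightIncl_rightTrunc n

end Truncation

/-- The degree in which the complexes in the image of an inclusion vanish. -/
def sideDegree (m : ℕ) : Side → ℤ
  | .left => 1
  | .right => m

/-- Identifies the essential image of each inclusion: vanishing in the one extreme degree is enough.
-/
lemma exists_incl_iso {m : ℕ} {s : Side} {X : FixedSize V (m + 1)}
    (hX : IsZero (X.obj.X (sideDegree (m + 1) s))) :
    ∃ X' : FixedSize V m, Nonempty ((incl V m s).obj X' ≅ X) := by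
  cases s
  · refine ⟨⟨(translate V 1).obj X.obj, fun j hj ↦ ?_⟩,
      ⟨ObjectProperty.isoMk _ ((translateTranslateIso 1 (-1) rfl).app X.obj)⟩⟩
    by_cases h : j + 1 = 1
    · exact hX.of_iso (X.obj.XIsoOfEq h)
    · exact X.property _ (by push_cast; lia)
  · refine ⟨⟨X.obj, fun j hj ↦ ?_⟩, ⟨Iso.refl _⟩⟩
    by_cases h : j = m + 1
    · exact hX.of_iso (X.obj.XIsoOfEq (h.trans (by simp [sideDegree])))
    · exact X.property _ (by push_cast; lia)

end Functors

/-! ### Irreducible and almost split morphisms in full subcategories -/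

section FullSubcategory

variable {C : Type*} [Category* C] {P : ObjectProperty C} {X Y : P.FullSubcategory}

lemma isSplitMono_hom_iff (f : X ⟶ Y) : IsSplitMono f.hom ↔ IsSplitMono f :=
  P.ι.isSplitMono_iff f

lemma isSplitEpi_hom_iff (f : X ⟶ Y) : IsSplitEpi f.hom ↔ IsSplitEpi f :=
  P.ι.isSplitEpi_iff f

/-- Allows the test objects to be built as plain cochain complexes, whose size is checked
afterwards. -/
lemma isIrreducible_iff_hom (f : X ⟶ Y) : IsIrreducible f ↔
    ¬ IsSplitMono f.hom ∧ ¬ IsSplitEpi f.hom ∧ ∀ (Z : C), P Z → ∀ (g : X.obj ⟶ Z) (h : Z ⟶ Y.obj),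
      g ≫ h = f.hom → IsSplitMono g ∨ IsSplitEpi h := by
  rw [isSplitMono_hom_iff, isSplitEpi_hom_iff]
  refine ⟨fun h ↦ ⟨h.1, h.2, fun Z hZ g k hgk ↦ ?_⟩, fun h ↦ ⟨h.1, h.2.1, fun Z g k hgk ↦ ?_⟩⟩
  · have := h.3 ⟨Z, hZ⟩ (ObjectProperty.homMk g) (ObjectProperty.homMk k) (by ext1; exact hgk)
    rwa [← isSplitMono_hom_iff, ← isSplitEpi_hom_iff] at this
  · rw [← isSplitMono_hom_iff, ← isSplitEpi_hom_iff]
    exact h.2.2 Z.obj Z.property g.hom k.hom (congrArg (fun t ↦ t.hom) hgk)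

lemma isLeftAlmostSplit_iff_hom (f : X ⟶ Y) : IsLeftAlmostSplit f ↔
    ¬ IsSplitMono f.hom ∧ ∀ (Z : C), P Z → ∀ (g : X.obj ⟶ Z), ¬ IsSplitMono g →
      ∃ s : Y.obj ⟶ Z, f.hom ≫ s = g := by
  rw [isSplitMono_hom_iff]
  refine ⟨fun h ↦ ⟨h.1, fun Z hZ g hg ↦ ?_⟩, fun h ↦ ⟨h.1, fun Z g hg ↦ ?_⟩⟩
  · obtain ⟨s, hs⟩ := h.2 ⟨Z, hZ⟩ (ObjectProperty.homMk g) (by rwa [← isSplitMono_hom_iff])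
    exact ⟨s.hom, congrArg (fun t ↦ t.hom) hs⟩
  · obtain ⟨s, hs⟩ := h.2 Z.obj Z.property g.hom (by rwa [isSplitMono_hom_iff])
    exact ⟨ObjectProperty.homMk s, by ext1; exact hs⟩

lemma IsMinimalLeft.isIso_hom {f : X ⟶ Y} (h : IsMinimalLeft f) (u : Y.obj ⟶ Y.obj)
    (hu : f.hom ≫ u = f.hom) : IsIso u :=
  (isMinimalLeft_map_iff P.ι).2 h u hu

end FullSubcategory

/-! ### Fixed-size complexes viewed among all cochain complexes. -/

section Complexes

variable {V : Type u} [Category.{v} V] [Preadditive V]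

lemma isFixedSize_iff {m : ℕ} {Z : CochainComplex V ℤ} :
    IsFixedSize V m Z ↔ VanishBelow 1 Z ∧ VanishAbove m Z :=
  ⟨fun h ↦ ⟨fun j hj ↦ h j (Or.inl hj), fun j hj ↦ h j (Or.inr hj)⟩,
    fun h j hj ↦ hj.elim (h.1 j) (h.2 j)⟩

lemma FixedSize.vanishBelow {m : ℕ} (X : FixedSize V m) : VanishBelow 1 X.obj :=
  (isFixedSize_iff.1 X.property).1

lemma FixedSize.vanishAbove {m : ℕ} (X : FixedSize V m) : VanishAbove m X.obj :=
  (isFixedSize_iff.1 X.property).2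

lemma IsFixedSize.of_retract {m : ℕ} {X Y : CochainComplex V ℤ} {i : Y ⟶ X} {p : X ⟶ Y}
    (h : i ≫ p = 𝟙 Y) (hX : IsFixedSize V m X) : IsFixedSize V m Y :=
  fun j hj ↦ isZero_X_of_retract h (hX j hj)

lemma FixedSize.not_isZero_obj {m : ℕ} {X : FixedSize V m} (h : ¬ IsZero X) : ¬ IsZero X.obj := by
  intro h'
  refine h ?_
  rw [IsZero.iff_id_eq_zero]
  ext1
  exact h'.eq_of_src _ _

/-- Summands of a complex of size `m` again have size `m`, so indecomposability in `C_m` and among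
all complexes agree. -/
lemma IsLengthBounded.isFitting [HasBinaryBiproducts V] {η : ℕ} (H : IsLengthBounded V η) {m : ℕ}
    {X : FixedSize V m} (hX : Indecomposable X) : IsFitting X.obj := by
  refine H.fitting X.obj 1 m X.vanishBelow X.vanishAbove
    ⟨FixedSize.not_isZero_obj hX.1, fun Y Z e ↦ ?_⟩
  let D := Decomp.ofIso e
  obtain ⟨e'⟩ := nonempty_iso_biprod (X := X) (Y := ⟨Y, X.property.of_retract D.i_p⟩)
    (Z := ⟨Z, X.property.of_retract D.j_q⟩) (i := ObjectProperty.homMk D.i)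
    (p := ObjectProperty.homMk D.p) (j := ObjectProperty.homMk D.j) (q := ObjectProperty.homMk D.q)
    (by ext1; exact D.i_p) (by ext1; exact D.j_q) (by ext1; exact D.total)
  rcases hX.2 _ _ e' with h | h
  · have := Functor.map_isZero (IsFixedSize V m).ι h
    exact Or.inl this
  · have := Functor.map_isZero (IsFixedSize V m).ι h
    exact Or.inr this

/-! ### Morphisms to and from truncations -/

section Truncations

variable {T Z : CochainComplex V ℤ} {a : ℤ}

lemma exists_inverses {P : ℤ → Prop} {f : T ⟶ Z} (hf : ∀ j, P j → IsIso (f.f j)) :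
    ∃ κ : ∀ j, Z.X j ⟶ T.X j, ∀ j, P j → f.f j ≫ κ j = 𝟙 _ ∧ κ j ≫ f.f j = 𝟙 _ := by
  have (j : ℤ) : ∃ κ : Z.X j ⟶ T.X j, P j → f.f j ≫ κ = 𝟙 _ ∧ κ ≫ f.f j = 𝟙 _ := by
    by_cases h : P j
    · have := hf j h
      exact ⟨inv (f.f j), fun _ ↦ by simp⟩
    · exact ⟨0, fun h' ↦ (h h').elim⟩
  choose κ hκ using this
  exact ⟨κ, hκ⟩

lemma exists_lift_subcomplex {ι : T ⟶ Z} (hι : ∀ j, a ≤ j → IsIso (ι.f j))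
    {X : CochainComplex V ℤ} (hX : VanishBelow a X) (g : X ⟶ Z) : ∃ g' : X ⟶ T, g' ≫ ι = g := by
  obtain ⟨κ, hκ⟩ := exists_inverses hι
  refine ⟨{ f := fun j ↦ g.f j ≫ κ j, comm' := fun i j hij ↦ ?_ }, ?_⟩
  · simp only [ComplexShape.up_Rel] at hij
    by_cases hi : i < a
    · exact (hX i hi).eq_of_src _ _
    · calc (g.f i ≫ κ i) ≫ T.d i j = g.f i ≫ κ i ≫ T.d i j ≫ ι.f j ≫ κ j := by
            rw [(hκ j (by lia)).1, Category.comp_id, Category.assoc]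
        _ = _ := by
            rw [← ι.comm_assoc, reassoc_of% (hκ i (by lia)).2, g.comm_assoc]
  · ext j
    by_cases hj : j < a
    · exact (hX j hj).eq_of_src _ _
    · change (g.f j ≫ κ j) ≫ ι.f j = g.f j
      rw [Category.assoc, (hκ j (by lia)).2, Category.comp_id]

/-- Extend `s` by zero below degree `a + 1`. The only condition is that `Z^a ⟶ Z^(a+1) ⟶ W^(a+1)`
vanishes; after the monomorphism `h` it equals `g^a` followed by the differential of `W'`, and `W'^a
= 0`. -/
lemma exists_extension_subcomplex {ι : T ⟶ Z} (hT : VanishBelow (a + 1) T)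
    (hι : ∀ j, a + 1 ≤ j → IsIso (ι.f j)) {W W' : CochainComplex V ℤ} {s : T ⟶ W} {h : W ⟶ W'}
    {g : Z ⟶ W'} (w : s ≫ h = ι ≫ g) (hh : Mono (h.f (a + 1))) (hW' : IsZero (W'.X a)) :
    ∃ s' : Z ⟶ W, ι ≫ s' = s := by
  obtain ⟨κ, hκ⟩ := exists_inverses hι
  have hι' (j : ℤ) : ι.f j ≫ κ j ≫ s.f j = s.f j := by
    by_cases hj : j < a + 1
    · exact (hT j hj).eq_of_src _ _
    · rw [reassoc_of% (hκ j (by lia)).1]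
  refine ⟨{ f := fun j ↦ κ j ≫ s.f j, comm' := fun i j hij ↦ ?_ }, by ext j; exact hι' j⟩
  simp only [ComplexShape.up_Rel] at hij
  subst hij
  rcases (show i < a ∨ i = a ∨ a < i by lia) with hi | rfl | hi
  · rw [(hT i (by lia)).eq_of_tgt (κ i) 0, (hT (i + 1) (by lia)).eq_of_tgt (κ (i + 1)) 0]
    simp
  · rw [(hT i (by lia)).eq_of_tgt (κ i) 0, ← cancel_mono (h.f (i + 1))]
    have hw := congrArg (fun t ↦ HomologicalComplex.Hom.f t (i + 1)) w
    simp only [HomologicalComplex.comp_f] at hw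
    rw [Category.assoc (Z.d _ _), Category.assoc, Category.assoc (κ _), hw, reassoc_of% (hκ (i + 1) (by lia)).2, ← g.comm,
      hW'.eq_of_tgt (g.f i) 0]
    simp
  · calc (κ i ≫ s.f i) ≫ W.d i (i + 1) = κ i ≫ (T.d i (i + 1) ≫ ι.f (i + 1) ≫ κ (i + 1)) ≫
          s.f (i + 1) := by
          rw [(hκ (i + 1) (by lia)).1, Category.comp_id, Category.assoc, s.comm]
      _ = _ := by
          rw [← ι.comm_assoc, Category.assoc, Category.assoc, reassoc_of% (hκ i (by lia)).2]

lemma eq_of_subcomplex {ι : T ⟶ Z} (hι : ∀ j, a ≤ j → IsIso (ι.f j)) {W : CochainComplex V ℤ}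
    (hW : VanishBelow a W) {g g' : Z ⟶ W} (h : ι ≫ g = ι ≫ g') : g = g' := by
  ext j
  by_cases hj : j < a
  · exact (hW j hj).eq_of_tgt _ _
  · have := hι j (by lia)
    rw [← cancel_epi (ι.f j)]
    exact congrArg (fun t ↦ HomologicalComplex.Hom.f t j) h

lemma exists_desc_quotient {π : Z ⟶ T} (hπ : ∀ j, j ≤ a → IsIso (π.f j))
    {Y : CochainComplex V ℤ} (hY : VanishAbove a Y) (g : Z ⟶ Y) : ∃ g' : T ⟶ Y, π ≫ g' = g := by
  obtain ⟨κ, hκ⟩ := exists_inverses hπ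
  refine ⟨{ f := fun j ↦ κ j ≫ g.f j, comm' := fun i j hij ↦ ?_ }, ?_⟩
  · simp only [ComplexShape.up_Rel] at hij
    by_cases hj : a < j
    · exact (hY j hj).eq_of_tgt _ _
    · calc (κ i ≫ g.f i) ≫ Y.d i j = κ i ≫ Z.d i j ≫ (π.f j ≫ κ j) ≫ g.f j := by
            rw [(hκ j (by lia)).1, Category.id_comp, Category.assoc, g.comm]
        _ = _ := by
            rw [Category.assoc, ← π.comm_assoc, reassoc_of% (hκ i (by lia)).2]
  · ext j
    by_cases hj : a < j
    · exact (hY j hj).eq_of_tgt _ _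
    · change π.f j ≫ κ j ≫ g.f j = g.f j
      rw [reassoc_of% (hκ j (by lia)).1]

lemma isZero_X_quotient {π : Z ⟶ T} (hT : VanishAbove a T) (hπ : ∀ j, j ≤ a → IsIso (π.f j))
    {j : ℤ} (hj : IsZero (Z.X j)) : IsZero (T.X j) := by
  by_cases h : a < j
  · exact hT j h
  · have := hπ j (by lia)
    exact hj.of_iso (asIso (π.f j)).symm

end Truncations

/-! ### Degreewise split sequences -/

/-- Degreewise splittings of a sequence of complexes. -/
structure DegreewiseSplit {X B Y : CochainComplex V ℤ} (f : X ⟶ B) (g : B ⟶ Y) where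
  /-- the retractions of the cells of `f` -/
  r (j : ℤ) : B.X j ⟶ X.X j
  /-- the sections of the cells of `g` -/
  s (j : ℤ) : Y.X j ⟶ B.X j
  f_r (j : ℤ) : f.f j ≫ r j = 𝟙 _
  s_g (j : ℤ) : s j ≫ g.f j = 𝟙 _
  total (j : ℤ) : r j ≫ f.f j + g.f j ≫ s j = 𝟙 _

namespace DegreewiseSplit

variable {X B Y : CochainComplex V ℤ} {f : X ⟶ B} {g : B ⟶ Y} (D : DegreewiseSplit f g)

include D

lemma f_r_assoc (j : ℤ) {T : V} (t : X.X j ⟶ T) : f.f j ≫ D.r j ≫ t = t := by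
  rw [← Category.assoc, D.f_r, Category.id_comp]

lemma s_g_assoc (j : ℤ) {T : V} (t : Y.X j ⟶ T) : D.s j ≫ g.f j ≫ t = t := by
  rw [← Category.assoc, D.s_g, Category.id_comp]

lemma comp_eq_zero : f ≫ g = 0 := by
  ext j
  have h := congrArg (fun t ↦ f.f j ≫ t ≫ g.f j) (D.total j)
  simpa [D.f_r_assoc, D.s_g] using h

lemma exists_desc {T : CochainComplex V ℤ} (w : B ⟶ T) (hw : f ≫ w = 0) :
    ∃ w' : Y ⟶ T, g ≫ w' = w := by
  have hw' (j : ℤ) : g.f j ≫ D.s j ≫ w.f j = w.f j := by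
    have h := congrArg (fun t ↦ t ≫ w.f j) (D.total j)
    have h0 : f.f j ≫ w.f j = 0 := congrArg (fun t ↦ HomologicalComplex.Hom.f t j) hw
    simpa [h0] using h
  refine ⟨{ f := fun j ↦ D.s j ≫ w.f j, comm' := fun i j _ ↦ ?_ }, by ext j; exact hw' j⟩
  calc (D.s i ≫ w.f i) ≫ T.d i j = D.s i ≫ B.d i j ≫ g.f j ≫ D.s j ≫ w.f j := by
        rw [hw', Category.assoc, w.comm]
    _ = _ := by rw [← g.comm_assoc, D.s_g_assoc]

lemma exists_lift {T : CochainComplex V ℤ} (w : T ⟶ B) (hw : w ≫ g = 0) :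
    ∃ w' : T ⟶ X, w' ≫ f = w := by
  have hw' (j : ℤ) : w.f j ≫ D.r j ≫ f.f j = w.f j := by
    have h := congrArg (fun t ↦ w.f j ≫ t) (D.total j)
    have h0 : w.f j ≫ g.f j = 0 := congrArg (fun t ↦ HomologicalComplex.Hom.f t j) hw
    simpa [reassoc_of% h0] using h
  refine ⟨{ f := fun j ↦ w.f j ≫ D.r j, comm' := fun i j _ ↦ ?_ }, by
    ext j; exact (Category.assoc _ _ _).trans (hw' j)⟩
  calc (w.f i ≫ D.r i) ≫ X.d i j = w.f i ≫ D.r i ≫ f.f i ≫ B.d i j ≫ D.r j := by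
        rw [f.comm_assoc, D.f_r, Category.comp_id, Category.assoc]
    _ = _ := by rw [reassoc_of% (hw' i), w.comm_assoc]

lemma mono : Mono f where
  right_cancellation {T} a b h := by
    ext j
    have := congrArg (fun t ↦ HomologicalComplex.Hom.f t j ≫ D.r j) h
    simpa [D.f_r] using this

lemma epi : Epi g where
  left_cancellation {T} a b h := by
    ext j
    have := congrArg (fun t ↦ D.s j ≫ HomologicalComplex.Hom.f t j) h
    simpa [D.s_g_assoc] using this

lemma isZero_X {j : ℤ} (hX : IsZero (X.X j)) (hY : IsZero (Y.X j)) : IsZero (B.X j) := by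
  rw [IsZero.iff_id_eq_zero, ← D.total j, hX.eq_of_tgt (D.r j) 0, hY.eq_of_tgt (g.f j) 0]
  simp

lemma isZero_X_right {j : ℤ} (hB : IsZero (B.X j)) : IsZero (Y.X j) :=
  isZero_of_retract _ _ (D.s_g j) hB

lemma mono_g_f {j : ℤ} (hX : IsZero (X.X j)) : Mono (g.f j) := by
  have h := D.total j
  rw [hX.eq_of_tgt (D.r j) 0, zero_comp, zero_add] at h
  exact mono_of_mono_fac (h := 𝟙 _) h

end DegreewiseSplit

lemma IsConflation.degreewiseSplit {m : ℕ} {S : ShortComplex (FixedSize V m)}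
    (hS : IsConflation S) : Nonempty (DegreewiseSplit S.f.hom S.g.hom) :=
  ⟨{ r := fun j ↦ (hS j).some.r
     s := fun j ↦ (hS j).some.s
     f_r := fun j ↦ (hS j).some.f_r
     s_g := fun j ↦ (hS j).some.s_g
     total := fun j ↦ (hS j).some.id }⟩

lemma isConflation_map_incl_iff {m : ℕ} {S : ShortComplex (FixedSize V m)} {s : Side} :
    IsConflation (S.map (incl V m s)) ↔ IsConflation S := by
  cases s
  · refine ⟨fun h j ↦ ?_, fun h j ↦ h (j + -1)⟩
    obtain ⟨i, rfl⟩ : ∃ i, j = i + -1 := ⟨j + 1, by lia⟩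
    exact h i
  · exact Iff.rfl

lemma isConflation_of_iso {m : ℕ} {S S' : ShortComplex (FixedSize V m)} (e : S ≅ S')
    (h : IsConflation S) : IsConflation S' := fun j ↦
  ⟨(h j).some.ofIso ((cell j).mapShortComplex.mapIso e)⟩

/-! ### Pullbacks of extensions and the right almost split property. -/

section Pullback

variable [HasBinaryBiproducts V]

/-- The sequence of a twisted sum is degreewise split. -/
noncomputable def twistSplit {X A : CochainComplex V ℤ} {θ : ∀ i j, A.X i ⟶ X.X j}
    (hs : ∀ i j, i + 1 ≠ j → θ i j = 0) (hθ : ∀ i j k, θ i j ≫ X.d j k + A.d i j ≫ θ j k = 0) :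
    DegreewiseSplit (twistInl hs hθ) (twistSnd hs hθ) where
  r j := (biprod.fst : X.X j ⊞ A.X j ⟶ X.X j)
  s j := (biprod.inr : A.X j ⟶ X.X j ⊞ A.X j)
  f_r _ := biprod.inl_fst
  s_g _ := biprod.inr_snd
  total _ := biprod.total

/-- Pullbacks of degreewise split sequences. -/
lemma DegreewiseSplit.exists_pullback {X B Y M : CochainComplex V ℤ} {f : X ⟶ B} {g : B ⟶ Y}
    (D : DegreewiseSplit f g) (k : M ⟶ Y) :
    ∃ (P : CochainComplex V ℤ) (i : X ⟶ P) (p : P ⟶ M) (v : P ⟶ B),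
      Nonempty (DegreewiseSplit i p) ∧ i ≫ v = f ∧ v ≫ g = p ≫ k := by
  -- The cocycle of the extension, `s ≫ d ≫ r`, pulled back along `k`.
  let θ (i j : ℤ) : M.X i ⟶ X.X j := k.f i ≫ D.s i ≫ B.d i j ≫ D.r j
  have hs (i j : ℤ) (hij : i + 1 ≠ j) : θ i j = 0 := by simp [θ, B.shape i j hij]
  have hθf (i j : ℤ) : θ i j ≫ f.f j = k.f i ≫ D.s i ≫ B.d i j - M.d i j ≫ k.f j ≫ D.s j := by
    have h : D.r j ≫ f.f j = 𝟙 _ - g.f j ≫ D.s j := eq_sub_of_add_eq (D.total j)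
    simp only [θ, Category.assoc, h, Preadditive.comp_sub, Category.comp_id]
    rw [← g.comm_assoc, D.s_g_assoc, k.comm_assoc]
  have hθ (i j l : ℤ) : θ i j ≫ X.d j l + M.d i j ≫ θ j l = 0 := by
    have : (θ i j ≫ X.d j l + M.d i j ≫ θ j l) ≫ f.f l = 0 := by
      rw [Preadditive.add_comp, Category.assoc (θ i j), Category.assoc (M.d i j), hθf, ← f.comm,
        ← Category.assoc (θ i j), hθf]
      simp
    simpa [D.f_r] using congrArg (fun t ↦ t ≫ D.r l) this
  refine ⟨twist X M θ hs hθ, twistInl hs hθ, twistSnd hs hθ,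
    twistDesc hs hθ f (fun j ↦ k.f j ≫ D.s j) (fun i j _ ↦ ?_), ⟨twistSplit hs hθ⟩, ?_, ?_⟩
  · rw [hθf]
    simp
  · ext j
    exact biprod.inl_desc _ _
  · ext j
    have h0 : f.f j ≫ g.f j = 0 := congrArg (fun t ↦ HomologicalComplex.Hom.f t j) D.comp_eq_zero
    have h : (biprod.desc (f.f j) (k.f j ≫ D.s j)) ≫ g.f j = biprod.snd ≫ k.f j := by
      ext
      · simp [h0]
      · simp [D.s_g]
    exact h

/-- The second morphism of a degreewise split sequence is right almost split if the first one is
left almost split and the endomorphism ring of the third term is local. -/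
lemma DegreewiseSplit.exists_lift_of_leftAlmostSplit {X B Y M : CochainComplex V ℤ} {f : X ⟶ B}
    {g : B ⟶ Y} (D : DegreewiseSplit f g) {m : ℕ} (hX : IsFixedSize V m X) (hM : IsFixedSize V m M)
    (hf : ¬ IsSplitMono f)
    (hf' : ∀ Z, IsFixedSize V m Z → ∀ k : X ⟶ Z, ¬ IsSplitMono k → ∃ s : B ⟶ Z, f ≫ s = k)
    (hY : IsFitting Y) (k : M ⟶ Y) (hk : ¬ IsSplitEpi k) : ∃ l : M ⟶ B, l ≫ g = k := by
  obtain ⟨P, i, p, v, ⟨D'⟩, hiv, hvg⟩ := D.exists_pullback k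
  -- If the pulled back sequence splits, a section of it lifts `k`. Otherwise `i` factors through
  -- `f`, giving a map of sequences from the given one to the pullback, with `t : Y ⟶ M` on the
  -- third terms.
  by_cases hi : IsSplitMono i
  · obtain ⟨⟨r, hr⟩⟩ := hi
    obtain ⟨w, hw⟩ := D'.exists_desc (𝟙 P - r ≫ i) (by simp [reassoc_of% hr])
    have hwp : w ≫ p = 𝟙 M := by
      have := D'.epi
      rw [← cancel_epi p, reassoc_of% hw]
      simp [D'.comp_eq_zero]
    exact ⟨w ≫ v, by rw [Category.assoc, hvg, reassoc_of% hwp]⟩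
  · obtain ⟨σ, hσ⟩ := hf' P (fun j hj ↦ D'.isZero_X (hX j hj) (hM j hj)) i hi
    obtain ⟨t, ht⟩ := D.exists_desc (σ ≫ p) (by rw [reassoc_of% hσ, D'.comp_eq_zero])
    let φ : End Y := t ≫ k
    have hφβ : g ≫ t ≫ k = (σ ≫ v) ≫ g := by rw [reassoc_of% ht, Category.assoc, hvg]
    have hβ : f ≫ σ ≫ v = f := by rw [reassoc_of% hσ, hiv]
    rcases hY φ with h | ⟨n, hn⟩
    · have : IsIso (t ≫ k) := (isUnit_iff_isIso _).1 h
      exact (hk ⟨⟨⟨inv (t ≫ k) ≫ t, by simp⟩⟩⟩).elim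
    -- Powers of `σ ≫ v` fix `f` and lie over the powers of `φ`. Once `φ ^ n = 0`, such a power maps
    -- into `X` and retracts `f`, a contradiction.
    · have hpow (n : ℕ) : ∃ (y : Y ⟶ Y) (b : B ⟶ B), (φ ^ n : End Y) = y ∧ g ≫ y = b ≫ g ∧
          f ≫ b = f := by
        induction n with
        | zero => exact ⟨𝟙 Y, 𝟙 B, rfl, by simp, by simp⟩
        | succ n ih =>
          obtain ⟨y, b, h₁, h₂, h₃⟩ := ih
          refine ⟨(t ≫ k) ≫ y, (σ ≫ v) ≫ b, by rw [pow_succ, h₁]; rfl, ?_, ?_⟩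
          · rw [← Category.assoc, hφβ, Category.assoc, h₂, ← Category.assoc]
          · rw [← Category.assoc, hβ, h₃]
      obtain ⟨y, b, h₁, h₂, h₃⟩ := hpow n
      obtain ⟨ρ, hρ⟩ := D.exists_lift b (by
        rw [← h₂, ← h₁]
        exact (congrArg (fun t ↦ g ≫ t) hn).trans comp_zero)
      have := D.mono
      exact (hf ⟨⟨⟨ρ, by rw [← cancel_mono f, Category.assoc, hρ, h₃, Category.id_comp]⟩⟩⟩).elim

end Pullback

end Complexes

/-! ### Passing from `C_m` to `C_(m+1)` and back -/

section LeftInclusion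

variable {V : Type u} [Category.{v} V] [Preadditive V]

lemma leftIncl_vanishBelow {m : ℕ} (X : FixedSize V m) :
    VanishBelow (1 + 1) ((leftIncl V m).obj X).obj :=
  fun j hj ↦ X.property (j + -1) (by lia)

/-- Makes the extension clause of `exists_coreflection` applicable with `h = 0`, so that every
morphism to such an `X` extends. -/
lemma mono_zero_f {m : ℕ} {X : FixedSize V m} (hX : IsZero (X.obj.X 1)) :
    Mono ((0 : (leftIncl V m).obj X ⟶ (leftIncl V m).obj X).hom.f (1 + 1)) where
  right_cancellation _ _ _ := by
    have : IsZero (((leftIncl V m).obj X).obj.X (1 + 1)) := hX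
    exact this.eq_of_tgt _ _

variable [HasZeroObject V]

/-- The left inclusion is coreflective. -/
lemma exists_coreflection {m : ℕ} (Z : FixedSize V (m + 1)) :
    ∃ (T : FixedSize V m) (j : (leftIncl V m).obj T ⟶ Z),
      (∀ (X : FixedSize V m) (g : (leftIncl V m).obj X ⟶ Z),
        ∃ g', (leftIncl V m).map g' ≫ j = g) ∧
      (∀ (W W' : FixedSize V (m + 1)) (s : (leftIncl V m).obj T ⟶ W) (h : W ⟶ W') (g : Z ⟶ W'),
        s ≫ h = j ≫ g → Mono (h.hom.f (1 + 1)) → IsZero (W'.obj.X 1) → ∃ s', j ≫ s' = s) ∧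
      (∀ (W : FixedSize V (m + 1)) (g g' : Z ⟶ W), IsZero (W.obj.X 1) → j ≫ g = j ≫ g' →
        g = g') := by
  -- The coreflection keeps the cells in degrees at least `2`.
  obtain ⟨T₀, ι, hT, hι⟩ := exists_subcomplex Z.obj (1 + 1)
  have hT₀ : IsFixedSize V (m + 1) T₀ := by
    rw [isFixedSize_iff]
    refine ⟨hT.mono (by lia), fun j hj ↦ ?_⟩
    by_cases h : j < 1 + 1
    · exact hT j h
    · have := hι j (by lia)
      exact (Z.vanishAbove j hj).of_iso (asIso (ι.f j))
  obtain ⟨T, ⟨e⟩⟩ : ∃ T, Nonempty ((leftIncl V m).obj T ≅ (⟨T₀, hT₀⟩ : FixedSize V (m + 1))) :=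
    exists_incl_iso (s := .left) (X := ⟨T₀, hT₀⟩) (hT 1 (by lia))
  let ι' : (⟨T₀, hT₀⟩ : FixedSize V (m + 1)) ⟶ Z := ObjectProperty.homMk ι
  refine ⟨T, e.hom ≫ ι', fun X g ↦ ?_, fun W W' s h g w hh hW' ↦ ?_, fun W g g' hW w ↦ ?_⟩
  · obtain ⟨g', hg'⟩ := exists_lift_subcomplex hι (leftIncl_vanishBelow X) g.hom
    let g'' : (leftIncl V m).obj X ⟶ ⟨T₀, hT₀⟩ := ObjectProperty.homMk g'
    have hg'' : g'' ≫ ι' = g := by ext1; exact hg'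
    refine ⟨(leftIncl V m).preimage (g'' ≫ e.inv), ?_⟩
    rw [Functor.map_preimage, Category.assoc, e.inv_hom_id_assoc, hg'']
  · have w' : (e.inv ≫ s) ≫ h = ι' ≫ g := by
      rw [Category.assoc, w, Category.assoc, e.inv_hom_id_assoc]
    obtain ⟨s', hs'⟩ := exists_extension_subcomplex hT hι (congrArg (fun t ↦ t.hom) w') hh hW'
    refine ⟨ObjectProperty.homMk s', ?_⟩
    have : ι' ≫ ObjectProperty.homMk s' = e.inv ≫ s := by ext1; exact hs'
    rw [Category.assoc, this, e.hom_inv_id_assoc]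
  · have hW' : VanishBelow (1 + 1) W.obj := fun j hj ↦ by
      rcases (show j < 1 ∨ j = 1 by lia) with h | rfl
      · exact W.vanishBelow j h
      · exact hW
    have w' : ι' ≫ g = ι' ≫ g' := by
      rwa [Category.assoc, Category.assoc, cancel_epi] at w
    ext1
    exact eq_of_subcomplex hι hW' (congrArg (fun t ↦ t.hom) w')

/-- A factorization through `Z` restricts to one through the coreflection `T`. Retractions onto `X`
extend from `T` to `Z` because the image of `X` vanishes in degrees `1` and `2`; sections into `T`
compose with `T ⟶ Z`. -/
lemma IsIrreducible.map_leftIncl {m : ℕ} {X Y : FixedSize V m} {f : X ⟶ Y} (hf : IsIrreducible f)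
    (hX : IsZero (X.obj.X 1)) : IsIrreducible ((leftIncl V m).map f) where
  not_section := by rw [Functor.isSplitMono_iff]; exact hf.1
  not_retraction := by rw [Functor.isSplitEpi_iff]; exact hf.2
  factor Z g h hgh := by
    obtain ⟨T, j, hj₁, hj₂, -⟩ := exists_coreflection Z
    obtain ⟨g', rfl⟩ := hj₁ X g
    obtain ⟨h', hh'⟩ := (leftIncl V m).map_surjective (j ≫ h)
    refine (hf.3 T g' h' ((leftIncl V m).map_injective ?_)).imp (fun H ↦ ?_) (fun H ↦ ?_)
    · rw [Functor.map_comp, hh', ← hgh, Category.assoc]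
    · obtain ⟨⟨r, hr⟩⟩ := H
      obtain ⟨s', hs'⟩ := hj₂ _ _ ((leftIncl V m).map r) 0 0 (by simp) (mono_zero_f hX)
        (leftIncl_vanishBelow X 1 (by lia))
      exact ⟨⟨⟨s', by
        rw [Category.assoc, hs', ← Functor.map_comp, hr, CategoryTheory.Functor.map_id]⟩⟩⟩
    · have := ((leftIncl V m).isSplitEpi_iff h').2 H
      rw [hh'] at this
      exact ⟨⟨⟨section_ (j ≫ h) ≫ j, by rw [Category.assoc, IsSplitEpi.id]⟩⟩⟩

lemma IsLeftAlmostSplit.map_leftIncl {m : ℕ} {X Y : FixedSize V m} {f : X ⟶ Y}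
    (hf : IsLeftAlmostSplit f) (hX : IsZero (X.obj.X 1)) :
    IsLeftAlmostSplit ((leftIncl V m).map f) where
  not_section := by rw [Functor.isSplitMono_iff]; exact hf.1
  factor Z g hg := by
    obtain ⟨T, j, hj₁, hj₂, -⟩ := exists_coreflection Z
    obtain ⟨g', rfl⟩ := hj₁ X g
    obtain ⟨s, hs⟩ := hf.2 T g' (fun H ↦ hg (by
      obtain ⟨⟨r, hr⟩⟩ := H
      obtain ⟨s', hs'⟩ := hj₂ _ _ ((leftIncl V m).map r) 0 0 (by simp) (mono_zero_f hX)
        (leftIncl_vanishBelow X 1 (by lia))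
      exact ⟨⟨⟨s', by
        rw [Category.assoc, hs', ← Functor.map_comp, hr, CategoryTheory.Functor.map_id]⟩⟩⟩))
    exact ⟨(leftIncl V m).map s ≫ j, by rw [← hs, Functor.map_comp, Category.assoc]⟩

/-- A lift over the coreflection of `Z` extends to `Z` by the monomorphism in degree `2`. In an
almost split sequence this monomorphism comes from the vanishing of the first term in that degree
(`DegreewiseSplit.mono_g_f`). -/
lemma IsRightAlmostSplit.map_leftIncl {m : ℕ} {X Y : FixedSize V m} {f : X ⟶ Y}
    (hf : IsRightAlmostSplit f) (hmono : Mono (((leftIncl V m).map f).hom.f (1 + 1))) :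
    IsRightAlmostSplit ((leftIncl V m).map f) where
  not_retraction := by rw [Functor.isSplitEpi_iff]; exact hf.1
  factor Z g hg := by
    obtain ⟨T, j, -, hj₂, hj₃⟩ := exists_coreflection Z
    obtain ⟨g', hg'⟩ := (leftIncl V m).map_surjective (j ≫ g)
    obtain ⟨s, hs⟩ := hf.2 T g' (fun H ↦ hg (by
      have := ((leftIncl V m).isSplitEpi_iff g').2 H
      rw [hg'] at this
      exact ⟨⟨⟨section_ (j ≫ g) ≫ j, by rw [Category.assoc, IsSplitEpi.id]⟩⟩⟩))
    have hY : IsZero (((leftIncl V m).obj Y).obj.X 1) := leftIncl_vanishBelow Y 1 (by lia)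
    have w : (leftIncl V m).map s ≫ (leftIncl V m).map f = j ≫ g := by
      rw [← Functor.map_comp, hs, hg']
    obtain ⟨s', hs'⟩ := hj₂ _ _ ((leftIncl V m).map s) ((leftIncl V m).map f) g w hmono hY
    exact ⟨s', hj₃ _ _ _ hY (by rw [← w, ← hs', Category.assoc])⟩

lemma IsAlmostSplitSequence.map_leftIncl {m : ℕ} {S : ShortComplex (FixedSize V m)}
    (hS : IsAlmostSplitSequence S) (hX : IsZero (S.X₁.obj.X 1)) :
    IsAlmostSplitSequence (S.map (incl V m .left)) where
  conflation := isConflation_map_incl_iff.2 hS.conflation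
  left_minimal := (isMinimalLeft_map_iff (incl V m .left)).2 hS.left_minimal
  right_minimal := (isMinimalRight_map_iff (incl V m .left)).2 hS.right_minimal
  left_almostSplit := hS.left_almostSplit.map_leftIncl hX
  right_almostSplit := by
    obtain ⟨D⟩ := hS.conflation.degreewiseSplit
    exact hS.right_almostSplit.map_leftIncl (D.mono_g_f (j := 1) hX)

end LeftInclusion

/-- Complexes in a common window of `η + 1` degrees lie in the image of an inclusion. -/
lemma exists_side_of_window {V : Type u} [Category.{v} V] [Preadditive V] {η m : ℕ}
    (hm : η + 1 ≤ m) {X Y : CochainComplex V ℤ}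
    (h : ∃ e : ℤ, 1 ≤ e ∧ VanishBelow e X ∧ VanishBelow e Y ∧ VanishAbove (e + η) X ∧
      VanishAbove (e + η) Y) :
    ∃ s : Side, IsZero (X.X (sideDegree (m + 1) s)) ∧ IsZero (Y.X (sideDegree (m + 1) s)) := by
  obtain ⟨e, he, h₁, h₂, h₃, h₄⟩ := h
  -- A window starting after degree `1` leaves degree `1` free; the window starting at `1` ends at
  -- `η + 1 ≤ m` and leaves degree `m + 1` free.
  rcases he.lt_or_eq with he | rfl
  · exact ⟨.left, h₁ _ he, h₂ _ he⟩
  · have : (1 : ℤ) + η < sideDegree (m + 1) .right := by simp only [sideDegree]; lia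
    exact ⟨.right, h₃ _ this, h₄ _ this⟩

/-! ### One step between `C_m` and `C_(m+1)` when `m ≥ η + 1`. -/

section OneStep

variable {V : Type u} [Category.{v} V] [Preadditive V] [HasZeroObject V]
variable [HasBinaryBiproducts V] [IsIdempotentComplete V] {η : ℕ} (H : IsLengthBounded V η)

include H

/-- The factorization of the morphisms in `C_(m+1)` from a complex that does not vanish in
degree `1` through `C_m`. -/
lemma IsLengthBounded.exists_factorization_fixedSize {m : ℕ} (hm : η + 1 ≤ m)
    {X Z : CochainComplex V ℤ} (hX : IsFitting X) (hXm : IsFixedSize V m X)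
    (h0 : ¬ IsZero (X.X 1)) (hZ : IsFixedSize V (m + 1) Z) (g : X ⟶ Z) :
    ∃ (A B U : CochainComplex V ℤ) (D : Decomp Z A B) (s : X ⟶ U) (t : U ⟶ B),
      s ≫ t = g ≫ D.q ∧ ¬ IsSplitMono s ∧ IsFixedSize V m A ∧ IsFixedSize V m U := by
  obtain ⟨hZ₁, hZ₂⟩ := isFixedSize_iff.1 hZ
  obtain ⟨hX₁, hX₂⟩ := isFixedSize_iff.1 hXm
  obtain ⟨A, B, ⟨D⟩, hA, hB⟩ := H.decomp Z 1 _ hZ₁ hZ₂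
  -- With `b = 0` the lowest degree of `X` is `1`, and `B` vanishes there by construction; both `A`
  -- and `U` end at `1 + η ≤ m`.
  obtain ⟨U, s, t, hst, hs, hU₁, -, hU₂⟩ := H.exists_factorization hX (b := 0) (q := (m + 1 : ℕ))
    hX₁ h0 (hX₂.mono (by lia)) (hB.mono (by lia)) (hZ₂.of_retract D.j_q) (g ≫ D.q)
  exact ⟨A, B, U, D, s, t, hst, hs,
    isFixedSize_iff.2 ⟨hZ₁.of_retract D.i_p, hA.mono (by lia)⟩,
    isFixedSize_iff.2 ⟨hU₁.mono (by lia), hU₂.mono (by lia)⟩⟩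

/-- When `X^1 ≠ 0`, a factorization through `Z = A ⊕ B` in `C_(m+1)` is replaced by one through `A ⊕
U`, which lies in `C_m`. -/
lemma IsIrreducible.exists_incl {m : ℕ} (hm : η + 1 ≤ m) {X Y : FixedSize V m}
    (hX : Indecomposable X) {f : X ⟶ Y} (hf : IsIrreducible f) :
    ∃ s : Side, IsIrreducible ((incl V m s).map f) := by
  by_cases h0 : IsZero (X.obj.X 1)
  · exact ⟨.left, hf.map_leftIncl h0⟩
  refine ⟨.right, ?_⟩
  have hF := H.isFitting hX
  rw [isIrreducible_iff_hom] at hf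
  have key : ∀ Z, IsFixedSize V (m + 1) Z → ∀ (g : X.obj ⟶ Z) (h : Z ⟶ Y.obj), g ≫ h = f.hom →
      IsSplitMono g ∨ IsSplitEpi h := ?_
  · exact (isIrreducible_iff_hom _).2 ⟨hf.1, hf.2.1, key⟩
  intro Z hZ g h hgh
  obtain ⟨A, B, U, D, s, t, hst, hs, hA, hU⟩ :=
    H.exists_factorization_fixedSize hm hF X.property h0 hZ g
  rcases hf.2.2 (A ⊞ U) (fun j hj ↦ biprod_isZero_X (hA j hj) (hU j hj))
    (biprod.lift (g ≫ D.p) s) (biprod.desc (D.i ≫ h) (t ≫ D.j ≫ h)) (by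
      rw [biprod.lift_desc, reassoc_of% hst, ← hgh, Category.assoc, ← Preadditive.comp_add]
      congr 1
      rw [← Category.assoc, ← Category.assoc, ← Preadditive.add_comp, D.total,
        Category.id_comp]) with h' | h'
  · obtain ⟨⟨r, hr⟩⟩ := h'
    -- By locality one of the components into `A` and `U` is a section; the one into `U` is not.
    have hr' : (g ≫ D.p) ≫ biprod.inl ≫ r + s ≫ biprod.inr ≫ r = 𝟙 X.obj := by
      rw [← hr, ← Category.assoc, ← Category.assoc, ← Preadditive.add_comp, biprod.lift_eq]
    obtain ⟨⟨r', hr''⟩⟩ := (hF.isSplitMono_or hr').resolve_right hs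
    exact Or.inl ⟨⟨⟨D.p ≫ r', by rw [← Category.assoc, hr'']⟩⟩⟩
  · obtain ⟨⟨r, hr⟩⟩ := h'
    refine Or.inr ⟨⟨⟨r ≫ biprod.desc D.i (t ≫ D.j), ?_⟩⟩⟩
    have : biprod.desc D.i (t ≫ D.j) ≫ h = biprod.desc (D.i ≫ h) (t ≫ D.j ≫ h) := by
      apply biprod.hom_ext' <;> simp
    rw [Category.assoc, this, hr]

/-- When `S.X₁` does not vanish in degree `1`, a non-section to `Z = A ⊕ B` extends along `S.f`
component by component, the second one through `U`. The right almost split property then follows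
from the left one by `DegreewiseSplit.exists_lift_of_leftAlmostSplit`. -/
lemma IsAlmostSplitSequence.exists_incl {m : ℕ} (hm : η + 1 ≤ m)
    {S : ShortComplex (FixedSize V m)} (h₁ : Indecomposable S.X₁) (h₃ : Indecomposable S.X₃)
    (hS : IsAlmostSplitSequence S) : ∃ s : Side, IsAlmostSplitSequence (S.map (incl V m s)) := by
  by_cases h0 : IsZero (S.X₁.obj.X 1)
  · exact ⟨.left, hS.map_leftIncl h0⟩
  refine ⟨.right, ?_⟩
  have hF := H.isFitting h₁
  obtain ⟨D⟩ := hS.conflation.degreewiseSplit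
  have hl := (isLeftAlmostSplit_iff_hom _).1 hS.left_almostSplit
  have hl' : ¬ IsSplitMono S.f.hom ∧ ∀ (Z : CochainComplex V ℤ), IsFixedSize V (m + 1) Z →
      ∀ (g : S.X₁.obj ⟶ Z), ¬ IsSplitMono g → ∃ s : S.X₂.obj ⟶ Z, S.f.hom ≫ s = g := by
    refine ⟨hl.1, fun Z hZ g hg ↦ ?_⟩
    obtain ⟨A, B, U, D, s, t, hst, hs, hA, hU⟩ :=
      H.exists_factorization_fixedSize hm hF S.X₁.property h0 hZ g
    obtain ⟨k₁, hk₁⟩ := hl.2 A hA (g ≫ D.p) (fun ⟨⟨r, hr⟩⟩ ↦ hg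
      ⟨⟨⟨D.p ≫ r, by rw [← Category.assoc, hr]⟩⟩⟩)
    obtain ⟨k₂, hk₂⟩ := hl.2 U hU s hs
    refine ⟨k₁ ≫ D.i + k₂ ≫ t ≫ D.j, ?_⟩
    rw [Preadditive.comp_add, reassoc_of% hk₁, reassoc_of% hk₂, reassoc_of% hst,
      ← Preadditive.comp_add, D.total, Category.comp_id]
  exact
    { conflation := isConflation_map_incl_iff.2 hS.conflation
      left_minimal := (isMinimalLeft_map_iff (incl V m .right)).2 hS.left_minimal
      right_minimal := (isMinimalRight_map_iff (incl V m .right)).2 hS.right_minimal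
      left_almostSplit := (isLeftAlmostSplit_iff_hom _).2 hl'
      right_almostSplit :=
        { not_retraction := fun h ↦ hS.right_almostSplit.1
            ((Functor.isSplitEpi_iff (incl V m .right) S.g).1 h)
          factor := fun M k hk ↦ by
            obtain ⟨l, hl⟩ := D.exists_lift_of_leftAlmostSplit (m := m + 1)
              ((incl V m .right).obj S.X₁).property M.property hl'.1 hl'.2 (H.isFitting h₃) k.hom
              (by rw [← isSplitEpi_hom_iff] at hk; exact hk)
            exact ⟨ObjectProperty.homMk l, by ext1; exact hl⟩ } }

lemma IsIrreducible.exists_side {m : ℕ} (hm : η + 1 ≤ m) {X Y : FixedSize V (m + 1)}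
    (hX : Indecomposable X) (hY : Indecomposable Y) {f : X ⟶ Y} (hf : IsIrreducible f) :
    ∃ s : Side, IsZero (X.obj.X (sideDegree (m + 1) s)) ∧
      IsZero (Y.obj.X (sideDegree (m + 1) s)) := by
  refine exists_side_of_window hm ?_
  have hFX := H.isFitting hX
  have hFY := H.isFitting hY
  obtain ⟨a, ha₁, ha, ha₀⟩ := exists_lowest X.vanishBelow (FixedSize.not_isZero_obj hX.1)
  obtain ⟨c, hc₁, hc, hc₀⟩ := exists_lowest Y.vanishBelow (FixedSize.not_isZero_obj hY.1)
  have hXa := H.vanishAbove hFX ha ha₀ X.vanishAbove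
  have hYc := H.vanishAbove hFY hc hc₀ Y.vanishAbove
  rw [isIrreducible_iff_hom] at hf
  by_cases hac : a < c
  -- `Y` vanishes in the lowest degree of `X`, so `f` factors through `U` by a non-section;
  -- irreducibility makes `Y` a retract of `U`.
  · obtain ⟨b, rfl⟩ : ∃ b, a = b + 1 := ⟨a - 1, by lia⟩
    obtain ⟨U, s, t, hst, hs, hU₁, hU₂, hU₃⟩ := H.exists_factorization hFX ha ha₀ X.vanishAbove
      (hc.mono (by lia)) Y.vanishAbove f.hom
    obtain ⟨⟨r, hr⟩⟩ := (hf.2.2 U (isFixedSize_iff.2 ⟨hU₁.mono ha₁, hU₂⟩) s t hst).resolve_left hs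
    exact ⟨b + 1, ha₁, ha, hc.mono hac.le, hXa, hU₃.of_retract hr⟩
  · refine ⟨c, hc₁, ha.mono (by lia), hc, ?_, hYc⟩
    -- Since `Y` ends at `c + η`, `f` factors through the truncation `Q` of `X`. Either `X` is a
    -- retract of `Q` and lies in the window, or `Y` is a retract of `Q`, which forces `a = c`.
    obtain ⟨Q, π, hQ, hπ⟩ := exists_quotient X.obj (c + η)
    obtain ⟨f', hf'⟩ := exists_desc_quotient hπ hYc f.hom
    rcases hf.2.2 Q (fun j hj ↦ isZero_X_quotient hQ hπ (X.property j hj)) π f' hf' with h | h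
    · obtain ⟨⟨r, hr⟩⟩ := h
      exact hQ.of_retract hr
    · obtain ⟨⟨r, hr⟩⟩ := h
      have : ¬ c < a := fun h' ↦ hc₀ (isZero_X_of_retract hr (isZero_X_quotient hQ hπ (ha c h')))
      obtain rfl : a = c := by lia
      exact hXa

/-- Left minimality replaces irreducibility: if an end left the common window, an endomorphism `u`
of the middle term with `f ≫ u = f` would vanish in a degree where the middle term is nonzero,
although `u` must be an automorphism. -/
lemma IsAlmostSplitSequence.exists_side {m : ℕ} (hm : η + 1 ≤ m)
    {S : ShortComplex (FixedSize V (m + 1))} (h₁ : Indecomposable S.X₁)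
    (h₃ : Indecomposable S.X₃) (hS : IsAlmostSplitSequence S) :
    ∃ s : Side, IsZero (S.X₁.obj.X (sideDegree (m + 1) s)) ∧
      IsZero (S.X₃.obj.X (sideDegree (m + 1) s)) := by
  refine exists_side_of_window hm ?_
  have hFX := H.isFitting h₁
  have hFY := H.isFitting h₃
  obtain ⟨D⟩ := hS.conflation.degreewiseSplit
  have hl := (isLeftAlmostSplit_iff_hom _).1 hS.left_almostSplit
  obtain ⟨a, ha₁, ha, ha₀⟩ := exists_lowest S.X₁.vanishBelow (FixedSize.not_isZero_obj h₁.1)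
  obtain ⟨c, hc₁, hc, hc₀⟩ := exists_lowest S.X₃.vanishBelow (FixedSize.not_isZero_obj h₃.1)
  have hXa := H.vanishAbove hFX ha ha₀ S.X₁.vanishAbove
  have hYc := H.vanishAbove hFY hc hc₀ S.X₃.vanishAbove
  have isZero_of {u : S.X₂.obj ⟶ S.X₂.obj} (hu : S.f.hom ≫ u = S.f.hom) {j : ℤ}
      (hj : u.f j = 0) : IsZero (S.X₂.obj.X j) := by
    have := hS.left_minimal.isIso_hom u hu
    have : IsIso (u.f j) :=
      inferInstanceAs (IsIso ((HomologicalComplex.eval V (ComplexShape.up ℤ) j).map u))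
    rw [IsZero.iff_id_eq_zero, ← cancel_mono (u.f j), hj]
    simp
  rcases lt_trichotomy a c with hac | rfl | hca
  · refine ⟨a, ha₁, ha, hc.mono hac.le, hXa, fun j hj ↦ D.isZero_X_right (B := S.X₂.obj) ?_⟩
    obtain ⟨b, rfl⟩ : ∃ b, a = b + 1 := ⟨a - 1, by lia⟩
    obtain ⟨A, C, ⟨E⟩, hA, hC⟩ := H.decomp S.X₂.obj (b + 1) _
      (fun j hj ↦ D.isZero_X (ha j hj) (hc j (by lia))) S.X₂.vanishAbove
    obtain ⟨U, s, t, hst, hs, hU₁, hU₂, hU₃⟩ := H.exists_factorization hFX ha ha₀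
      S.X₁.vanishAbove (hC.mono (by lia)) (S.X₂.vanishAbove.of_retract E.j_q) (S.f.hom ≫ E.q)
    obtain ⟨k, hk⟩ := hl.2 U (isFixedSize_iff.2 ⟨hU₁.mono ha₁, hU₂⟩) s hs
    -- The component of `S.f` into `C` is rerouted through `U`; both `A` and `U` vanish above the
    -- window, hence so does `u`.
    refine isZero_of (u := E.p ≫ E.i + k ≫ t ≫ E.j) ?_ ?_
    · rw [Preadditive.comp_add, reassoc_of% hk, reassoc_of% hst, ← Preadditive.comp_add, E.total,
        Category.comp_id]
    · simp only [HomologicalComplex.add_f_apply, HomologicalComplex.comp_f,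
        (hA j hj).eq_of_tgt (E.p.f j) 0, (hU₃ j hj).eq_of_tgt (k.f j) 0, zero_comp, add_zero]
  · exact ⟨a, ha₁, ha, hc, hXa, hYc⟩
  · refine ⟨c, hc₁, ha.mono hca.le, hc, ?_, hYc⟩
    by_contra hX
    obtain ⟨A, C, ⟨E⟩, hA, hC⟩ := H.decomp S.X₂.obj c _
      (fun j hj ↦ D.isZero_X (ha j (by lia)) (hc j hj)) S.X₂.vanishAbove
    obtain ⟨Q, π, hQ, hπ⟩ := exists_quotient S.X₁.obj (c + η)
    obtain ⟨f', hf'⟩ := exists_desc_quotient hπ hA (S.f.hom ≫ E.p)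
    obtain ⟨k, hk⟩ := hl.2 Q (fun j hj ↦ isZero_X_quotient hQ hπ (S.X₁.property j hj)) π
      (fun ⟨⟨r, hr⟩⟩ ↦ hX (hQ.of_retract hr))
    -- Here `u` reroutes the component into `A` through `Q`. It vanishes in degree `c` since `Q^c =
    -- 0` and `C^c = 0`, so the middle term and `Y` would vanish there.
    refine hc₀ (D.isZero_X_right (isZero_of (u := k ≫ f' ≫ E.i + E.q ≫ E.j) ?_ ?_))
    · rw [Preadditive.comp_add, reassoc_of% hk, reassoc_of% hf', ← Preadditive.comp_add, E.total,
        Category.comp_id]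
    · simp only [HomologicalComplex.add_f_apply, HomologicalComplex.comp_f,
        (isZero_X_quotient hQ hπ (ha c hca)).eq_of_tgt (k.f c) 0,
        (hC c (by lia)).eq_of_tgt (E.q.f c) 0, zero_comp, add_zero]

end OneStep

/-! ### Passing from `C_n` to `C_(n+k)` and back -/

section Iterated

variable {V : Type u} [Category.{v} V] [Preadditive V]

instance (n k : ℕ) (w : Fin k → Side) : (iterIncl V n k w).Faithful := by
  induction k with
  | zero => exact inferInstanceAs (𝟭 _).Faithful
  | succ k ih =>
    have := ih (fun i ↦ w i.castSucc)
    exact inferInstanceAs (_ ⋙ _ : _ ⥤ _).Faithful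

instance (n k : ℕ) (w : Fin k → Side) : (iterIncl V n k w).Full := by
  induction k with
  | zero => exact inferInstanceAs (𝟭 _).Full
  | succ k ih =>
    have := ih (fun i ↦ w i.castSucc)
    exact inferInstanceAs (_ ⋙ _ : _ ⥤ _).Full

lemma iterIncl_snoc (n k : ℕ) (w : Fin k → Side) (s : Side) :
    iterIncl V n (k + 1) (Fin.snoc (α := fun _ ↦ Side) w s) =
      iterIncl V n k w ⋙ incl V (n + k) s := by
  simp [iterIncl, Fin.snoc_castSucc, Fin.snoc_last]

lemma iterIncl_iterTrunc [HasZeroObject V] (n k : ℕ) (w : Fin k → Side) :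
    Nonempty (iterIncl V n k w ⋙ iterTrunc V n k w ≅ 𝟭 _) := by
  induction k with
  | zero => exact ⟨Iso.refl _⟩
  | succ k ih =>
    obtain ⟨e⟩ := ih (fun i ↦ w i.castSucc)
    obtain ⟨e'⟩ := incl_trunc (V := V) (n + k) (w (Fin.last k))
    exact ⟨Functor.isoWhiskerLeft (iterIncl V n k fun i ↦ w i.castSucc)
      (Functor.isoWhiskerRight e' (iterTrunc V n k fun i ↦ w i.castSucc)) ≪≫ e⟩

lemma IsAlmostSplitSequence.of_iso {m : ℕ} {S S' : ShortComplex (FixedSize V m)} (e : S ≅ S')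
    (h : IsAlmostSplitSequence S) : IsAlmostSplitSequence S' := by
  let e₁ := ShortComplex.π₁.mapIso e
  let e₂ := ShortComplex.π₂.mapIso e
  let e₃ := ShortComplex.π₃.mapIso e
  have hf : e₁.hom ≫ S'.f = S.f ≫ e₂.hom := e.hom.comm₁₂
  have hg : e₂.hom ≫ S'.g = S.g ≫ e₃.hom := e.hom.comm₂₃
  exact
    { conflation := isConflation_of_iso e h.conflation
      left_almostSplit := h.left_almostSplit.of_iso e₁ e₂ hf
      left_minimal := h.left_minimal.of_iso e₁ e₂ hf
      right_almostSplit := h.right_almostSplit.of_iso e₂ e₃ hg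
      right_minimal := h.right_minimal.of_iso e₂ e₃ hg }

lemma isConflation_map_iterIncl_iff {n k : ℕ} {S : ShortComplex (FixedSize V n)}
    {w : Fin k → Side} : IsConflation (S.map (iterIncl V n k w)) ↔ IsConflation S := by
  induction k with
  | zero => exact Iff.rfl
  | succ k ih =>
    exact (isConflation_map_incl_iff (S := S.map (iterIncl V n k fun i ↦ w i.castSucc))).trans ih

lemma IsAlmostSplitSequence.of_map_iterIncl {n k : ℕ} {S : ShortComplex (FixedSize V n)}
    {w : Fin k → Side} (h : IsAlmostSplitSequence (S.map (iterIncl V n k w))) :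
    IsAlmostSplitSequence S where
  conflation := isConflation_map_iterIncl_iff.1 h.conflation
  left_almostSplit := h.left_almostSplit.of_map (iterIncl V n k w)
  left_minimal := (isMinimalLeft_map_iff (iterIncl V n k w)).1 h.left_minimal
  right_almostSplit := h.right_almostSplit.of_map (iterIncl V n k w)
  right_minimal := (isMinimalRight_map_iff (iterIncl V n k w)).1 h.right_minimal

lemma IsAlmostSplitSequence.of_map_incl {n : ℕ} {S : ShortComplex (FixedSize V n)} {s : Side}
    (h : IsAlmostSplitSequence (S.map (incl V n s))) : IsAlmostSplitSequence S where
  conflation := isConflation_map_incl_iff.1 h.conflation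
  left_almostSplit := h.left_almostSplit.of_map (incl V n s)
  left_minimal := (isMinimalLeft_map_iff (incl V n s)).1 h.left_minimal
  right_almostSplit := h.right_almostSplit.of_map (incl V n s)
  right_minimal := (isMinimalRight_map_iff (incl V n s)).1 h.right_minimal

variable [HasBinaryBiproducts V] {η : ℕ} (H : IsLengthBounded V η)

include H

/-- Indecomposability is carried along through the endomorphism ring, which a fully faithful functor
preserves. -/
lemma IsLengthBounded.indecomposable_map {n n' : ℕ} (F : FixedSize V n ⥤ FixedSize V n')
    [F.Full] [F.Faithful] [F.PreservesZeroMorphisms] {X : FixedSize V n}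
    (hX : Indecomposable X) : Indecomposable (F.obj X) := by
  refine ((IsFitting.of_map (IsFixedSize V n).ι (H.isFitting hX)).map F).indecomposable
    fun h ↦ hX.1 ?_
  rw [IsZero.iff_id_eq_zero] at h ⊢
  exact F.map_injective (by rw [CategoryTheory.Functor.map_id, h, CategoryTheory.Functor.map_zero])

lemma IsLengthBounded.indecomposable_of_iso {n n' : ℕ} (F : FixedSize V n ⥤ FixedSize V n')
    [F.Full] [F.Faithful] [F.PreservesZeroMorphisms] {X : FixedSize V n} {Y : FixedSize V n'}
    (e : F.obj X ≅ Y) (hY : Indecomposable Y) : Indecomposable X := by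
  have hF : Indecomposable (F.obj X) :=
    ⟨fun h ↦ hY.1 (h.of_iso e.symm), fun A B e' ↦ hY.2 A B (e.symm ≪≫ e')⟩
  exact ((IsFitting.of_map (IsFixedSize V n').ι (H.isFitting hF)).of_map F).indecomposable fun h ↦ hY.1 ((F.map_isZero h).of_iso e.symm)

variable [HasZeroObject V] [IsIdempotentComplete V]

lemma IsIrreducible.exists_iterIncl {n : ℕ} (hn : η + 1 ≤ n) {X Y : FixedSize V n}
    (hX : Indecomposable X) {f : X ⟶ Y} (hf : IsIrreducible f) (k : ℕ) :
    ∃ w : Fin k → Side, IsIrreducible ((iterIncl V n k w).map f) := by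
  induction k with
  | zero => exact ⟨Fin.elim0, hf⟩
  | succ k ih =>
    obtain ⟨w, hw⟩ := ih
    obtain ⟨s, hs⟩ := hw.exists_incl H (by lia) (H.indecomposable_map (iterIncl V n k w) hX)
    exact ⟨Fin.snoc (α := fun _ ↦ Side) w s, by rw [iterIncl_snoc]; exact hs⟩

lemma IsAlmostSplitSequence.exists_iterIncl {n : ℕ} (hn : η + 1 ≤ n)
    {S : ShortComplex (FixedSize V n)} (h₁ : Indecomposable S.X₁) (h₃ : Indecomposable S.X₃)
    (hS : IsAlmostSplitSequence S) (k : ℕ) :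
    ∃ w : Fin k → Side, IsAlmostSplitSequence (S.map (iterIncl V n k w)) := by
  induction k with
  | zero => exact ⟨Fin.elim0, hS⟩
  | succ k ih =>
    obtain ⟨w, hw⟩ := ih
    obtain ⟨s, hs⟩ := hw.exists_incl H (by lia) (H.indecomposable_map (iterIncl V n k w) h₁)
      (H.indecomposable_map (iterIncl V n k w) h₃)
    refine ⟨Fin.snoc (α := fun _ ↦ Side) w s, ?_⟩
    simp only [iterIncl_snoc]
    exact hs

lemma IsIrreducible.exists_iterIncl_iso {n : ℕ} (hn : η + 1 ≤ n) {k : ℕ}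
    {X Y : FixedSize V (n + k)} (hX : Indecomposable X) (hY : Indecomposable Y) {f : X ⟶ Y}
    (hf : IsIrreducible f) :
    ∃ (w : Fin k → Side) (X' Y' : FixedSize V n) (f' : X' ⟶ Y'),
      Nonempty (Arrow.mk ((iterIncl V n k w).map f') ≅ Arrow.mk f) := by
  induction k with
  | zero => exact ⟨Fin.elim0, X, Y, f, ⟨Iso.refl _⟩⟩
  | succ k ih =>
    obtain ⟨s, hX₀, hY₀⟩ := hf.exists_side (m := n + k) H (by lia) hX hY
    obtain ⟨X₁, ⟨a⟩⟩ := exists_incl_iso hX₀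
    obtain ⟨Y₁, ⟨b⟩⟩ := exists_incl_iso hY₀
    obtain ⟨f₁, hf₁⟩ := (incl V (n + k) s).map_surjective (a.hom ≫ f ≫ b.inv)
    have w₁ : (incl V (n + k) s).map f₁ ≫ b.hom = a.hom ≫ f := by
      rw [hf₁, Category.assoc, Category.assoc, b.inv_hom_id, Category.comp_id]
    have hirr : IsIrreducible f₁ := (hf.of_iso a.symm b.symm (by
      rw [hf₁]; exact a.inv_hom_id_assoc _)).of_map (incl V (n + k) s)
    obtain ⟨w, X', Y', f', ⟨e⟩⟩ := ih (H.indecomposable_of_iso _ a hX)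
      (H.indecomposable_of_iso _ b hY) hirr
    refine ⟨Fin.snoc (α := fun _ ↦ Side) w s, X', Y', f', ?_⟩
    rw [iterIncl_snoc]
    exact ⟨(incl V (n + k) s).mapArrow.mapIso e ≪≫ Arrow.isoMk a b w₁.symm⟩

lemma IsAlmostSplitSequence.exists_iterIncl_iso {n : ℕ} (hn : η + 1 ≤ n) {k : ℕ}
    {S : ShortComplex (FixedSize V (n + k))} (h₁ : Indecomposable S.X₁)
    (h₃ : Indecomposable S.X₃) (hS : IsAlmostSplitSequence S) :
    ∃ (w : Fin k → Side) (S' : ShortComplex (FixedSize V n)),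
      Nonempty (S'.map (iterIncl V n k w) ≅ S) := by
  induction k with
  | zero => exact ⟨Fin.elim0, S, ⟨Iso.refl _⟩⟩
  | succ k ih =>
    obtain ⟨s, hX₁, hX₃⟩ := hS.exists_side (m := n + k) H (by lia) h₁ h₃
    obtain ⟨D⟩ := hS.conflation.degreewiseSplit
    obtain ⟨Y₁, ⟨e₁⟩⟩ := exists_incl_iso hX₁
    -- The middle term vanishes wherever both ends do, so the whole sequence descends.
    obtain ⟨Y₂, ⟨e₂⟩⟩ := exists_incl_iso (D.isZero_X hX₁ hX₃)
    obtain ⟨Y₃, ⟨e₃⟩⟩ := exists_incl_iso hX₃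
    obtain ⟨f, hf⟩ := (incl V (n + k) s).map_surjective (e₁.hom ≫ S.f ≫ e₂.inv)
    obtain ⟨g, hg⟩ := (incl V (n + k) s).map_surjective (e₂.hom ≫ S.g ≫ e₃.inv)
    let S₁ := ShortComplex.mk f g ((incl V (n + k) s).map_injective (by
      rw [Functor.map_comp, hf, hg, CategoryTheory.Functor.map_zero]; simp))
    have wf : (incl V (n + k) s).map f ≫ e₂.hom = e₁.hom ≫ S.f := by
      rw [hf, Category.assoc, Category.assoc, e₂.inv_hom_id, Category.comp_id]
    have wg : (incl V (n + k) s).map g ≫ e₃.hom = e₂.hom ≫ S.g := by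
      rw [hg, Category.assoc, Category.assoc, e₃.inv_hom_id, Category.comp_id]
    let e : S₁.map (incl V (n + k) s) ≅ S := ShortComplex.isoMk e₁ e₂ e₃ wf.symm wg.symm
    obtain ⟨w, S', ⟨e'⟩⟩ := ih (S := S₁) (H.indecomposable_of_iso _ e₁ h₁)
      (H.indecomposable_of_iso _ e₃ h₃) (hS.of_iso e.symm).of_map_incl
    refine ⟨Fin.snoc (α := fun _ ↦ Side) w s, S', ?_⟩
    simp only [iterIncl_snoc]
    exact ⟨(incl V (n + k) s).mapShortComplex.mapIso e' ≪≫ e⟩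

lemma IsIrreducible.exists_iterTrunc {n : ℕ} (hn : η + 1 ≤ n) {k : ℕ}
    {X Y : FixedSize V (n + k)} (hX : Indecomposable X) (hY : Indecomposable Y) {f : X ⟶ Y}
    (hf : IsIrreducible f) :
    ∃ w : Fin k → Side,
      Indecomposable ((iterTrunc V n k w).obj X) ∧ Indecomposable ((iterTrunc V n k w).obj Y) ∧
      IsIrreducible ((iterTrunc V n k w).map f) ∧
      Nonempty (Arrow.mk f ≅ Arrow.mk ((iterIncl V n k w).map ((iterTrunc V n k w).map f))) := by
  obtain ⟨w, X', Y', f', ⟨e⟩⟩ := hf.exists_iterIncl_iso H hn hX hY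
  obtain ⟨τ⟩ := iterIncl_iterTrunc (V := V) n k w
  -- Since `T_w I_w ≅ 𝟭`, truncating `I_w(f') ≅ f` identifies `f'` with `T_w(f)`.
  let e' : Arrow.mk f' ≅ Arrow.mk ((iterTrunc V n k w).map f) :=
    ((Functor.mapArrowFunctor _ _).mapIso τ.symm).app (Arrow.mk f') ≪≫
      (iterTrunc V n k w).mapArrow.mapIso e
  let i : Arrow.mk ((iterIncl V n k w).map ((iterTrunc V n k w).map f)) ≅ Arrow.mk f :=
    (iterIncl V n k w).mapArrow.mapIso e'.symm ≪≫ e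
  let a := Arrow.leftFunc.mapIso i
  let b := Arrow.rightFunc.mapIso i
  refine ⟨w, H.indecomposable_of_iso (iterIncl V n k w) a hX,
    H.indecomposable_of_iso (iterIncl V n k w) b hY, ?_, ⟨i.symm⟩⟩
  exact (hf.of_iso a.symm b.symm i.inv.w).of_map (iterIncl V n k w)

lemma IsAlmostSplitSequence.exists_iterTrunc {n : ℕ} (hn : η + 1 ≤ n) {k : ℕ}
    {S : ShortComplex (FixedSize V (n + k))} (h₁ : Indecomposable S.X₁)
    (h₃ : Indecomposable S.X₃) (hS : IsAlmostSplitSequence S) :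
    ∃ w : Fin k → Side,
      Indecomposable (S.map (iterTrunc V n k w)).X₁ ∧
      Indecomposable (S.map (iterTrunc V n k w)).X₃ ∧
      IsAlmostSplitSequence (S.map (iterTrunc V n k w)) ∧
      Nonempty (S ≅ (S.map (iterTrunc V n k w)).map (iterIncl V n k w)) := by
  obtain ⟨w, S', ⟨e⟩⟩ := hS.exists_iterIncl_iso H hn h₁ h₃
  obtain ⟨τ⟩ := iterIncl_iterTrunc (V := V) n k w
  let e' : S' ≅ S.map (iterTrunc V n k w) :=
    S'.mapNatIso τ.symm ≪≫ (iterTrunc V n k w).mapShortComplex.mapIso e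
  let i : (S.map (iterTrunc V n k w)).map (iterIncl V n k w) ≅ S :=
    (iterIncl V n k w).mapShortComplex.mapIso e'.symm ≪≫ e
  exact ⟨w, H.indecomposable_of_iso (iterIncl V n k w) (ShortComplex.π₁.mapIso i) h₁,
    H.indecomposable_of_iso (iterIncl V n k w) (ShortComplex.π₃.mapIso i) h₃,
    (hS.of_iso i.symm).of_map_iterIncl, ⟨i.symm⟩⟩

end Iterated

/-! ### The category `proj Λ` -/

section Algebra

variable (Λ : Type u) [Ring Λ]

instance : IsIdempotentComplete (Proj Λ) where
  idempotents_split P p hp := by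
    obtain ⟨Y, i, e, hie, hei⟩ := IsIdempotentComplete.idempotents_split P.obj p.hom
      (congrArg (fun t ↦ t.hom) hp)
    have := P.property.1
    have := P.property.2
    have h : e.hom ∘ₗ i.hom = LinearMap.id := congrArg ModuleCat.Hom.hom hie
    refine ⟨⟨Y, Module.Finite.of_surjective e.hom fun y ↦ ⟨i.hom y, LinearMap.congr_fun h y⟩,
      Module.Projective.of_split i.hom e.hom h⟩, ObjectProperty.homMk i, ObjectProperty.homMk e,
      by ext1; exact hie, by ext1; exact hei⟩

variable (K : Type v) [Field K] [Algebra K Λ]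

instance : Linear K (Proj Λ) :=
  inferInstanceAs (Linear K (IsFGProjective Λ).FullSubcategory)

open scoped ModuleCat in
lemma finite_hom [FiniteDimensional K Λ] (X Y : Proj Λ) : Module.Finite K (X ⟶ Y) := by
  have := X.property.1
  have := Y.property.1
  have : Module.Finite K Λᵐᵒᵖ := Module.Finite.equiv (MulOpposite.opLinearEquiv K)
  have : Module.Finite K X.obj := Module.Finite.trans Λᵐᵒᵖ X.obj
  have : Module.Finite K Y.obj := Module.Finite.trans Λᵐᵒᵖ Y.obj
  let φ : (X ⟶ Y) →ₗ[K] (X.obj →ₗ[K] Y.obj) :=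
    { toFun := fun f ↦ f.hom.hom.restrictScalars K
      map_add' := fun _ _ ↦ rfl
      map_smul' := fun _ _ ↦ rfl }
  refine Module.Finite.of_injective φ fun f g h ↦ ?_
  ext x
  exact LinearMap.congr_fun h x

variable {Λ} in
lemma isLengthBounded_proj [FiniteDimensional K Λ] {η : ℕ}
    (hη : strongGlobalDimension Λ = (η : ℕ∞)) (hη_pos : 1 ≤ η) :
    IsLengthBounded (Proj Λ) η := by
  have := finite_hom Λ K
  refine isLengthBounded K hη_pos fun X l hX hl ↦ ?_
  have : (l : ℕ∞) ≤ strongGlobalDimension Λ := le_sSup ⟨X, l, hX, hl, rfl⟩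
  rwa [hη, Nat.cast_le] at this

end Algebra

end CnProj

open CnProj

/-- Here `k = i - 1`, so that `FixedSize (Proj Λ) (η + 1 + k)` is `C_(η+i)(proj Λ)` with `i ≥ 2`. -/
theorem corollary2p17 {K : Type v} [Field K] [IsAlgClosed K]
    {Λ : Type u} [Ring Λ] [Algebra K Λ] [FiniteDimensional K Λ]
    (η : ℕ) (hη : strongGlobalDimension Λ = (η : ℕ∞)) (hη_pos : 1 ≤ η)
    (k : ℕ) (hk : 1 ≤ k) :
    -- irreducible morphisms of `C_(η+1)`, characterized in `C_(η+i)` through inclusions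
    (∀ (X Y : FixedSize (Proj Λ) (η + 1)), Indecomposable X → Indecomposable Y →
      ∀ f : X ⟶ Y,
        (IsIrreducible f ↔
          ∃ w : Fin k → Side, IsIrreducible ((iterIncl (Proj Λ) (η + 1) k w).map f))) ∧
    -- irreducible morphisms of `C_(η+i)` come from `C_(η+1)` through truncations
    (∀ (X Y : FixedSize (Proj Λ) (η + 1 + k)), Indecomposable X → Indecomposable Y →
      ∀ f : X ⟶ Y, IsIrreducible f →
        ∃ w : Fin k → Side,
          Indecomposable ((iterTrunc (Proj Λ) (η + 1) k w).obj X) ∧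
          Indecomposable ((iterTrunc (Proj Λ) (η + 1) k w).obj Y) ∧
          IsIrreducible ((iterTrunc (Proj Λ) (η + 1) k w).map f) ∧
          Nonempty (Arrow.mk f ≅ Arrow.mk ((iterIncl (Proj Λ) (η + 1) k w).map
            ((iterTrunc (Proj Λ) (η + 1) k w).map f)))) ∧
    -- almost split sequences of `C_(η+1)`, characterized in `C_(η+i)` through inclusions
    (∀ S : ShortComplex (FixedSize (Proj Λ) (η + 1)),
      Indecomposable S.X₁ → Indecomposable S.X₃ →
        (IsAlmostSplitSequence S ↔
          ∃ w : Fin k → Side,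
            IsAlmostSplitSequence (S.map (iterIncl (Proj Λ) (η + 1) k w)))) ∧
    -- almost split sequences of `C_(η+i)` come from `C_(η+1)` through truncations
    (∀ S : ShortComplex (FixedSize (Proj Λ) (η + 1 + k)),
      Indecomposable S.X₁ → Indecomposable S.X₃ → IsAlmostSplitSequence S →
        ∃ w : Fin k → Side,
          Indecomposable (S.map (iterTrunc (Proj Λ) (η + 1) k w)).X₁ ∧
          Indecomposable (S.map (iterTrunc (Proj Λ) (η + 1) k w)).X₃ ∧
          IsAlmostSplitSequence (S.map (iterTrunc (Proj Λ) (η + 1) k w)) ∧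
          Nonempty (S ≅ (S.map (iterTrunc (Proj Λ) (η + 1) k w)).map
            (iterIncl (Proj Λ) (η + 1) k w))) := by
  have H := isLengthBounded_proj K hη hη_pos
  -- In both equivalences the passage back from `C_(η+i)` uses only that `I_w` is fully faithful and
  -- reflects conflations.
  refine ⟨fun X Y hX _ f ↦ ⟨fun hf ↦ hf.exists_iterIncl H le_rfl hX k,
      fun ⟨w, hw⟩ ↦ hw.of_map (iterIncl (Proj Λ) (η + 1) k w)⟩,
    fun X Y hX hY f hf ↦ hf.exists_iterTrunc H le_rfl hX hY,
    fun S h₁ h₃ ↦ ⟨fun hS ↦ hS.exists_iterIncl H le_rfl h₁ h₃ k,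
      fun ⟨w, hw⟩ ↦ hw.of_map_iterIncl⟩,
    fun S h₁ h₃ hS ↦ hS.exists_iterTrunc H le_rfl h₁ h₃⟩
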